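/- All graphs are finite, simple and non-null (they have at least one vertex). A \emph{cutset} of a graph $G$ is a (possibly empty) set $C \subseteq V(G)$ such that $G \setminus C$ is disconnected; $G$ is \emph{$k$-connected} if it has at least $k+1$ vertices and no cutset of size at most $k-1$. A \emph{cut-partition} of $G$ is a partition $(A,B,C)$ of $V(G)$ such that $A$ and $B$ are non-empty ($C$ may be empty) and there is no edge between $A$ and $B$. A class of graphs is \emph{hereditary} if it is closed under isomorphism and under taking induced subgraphs. A graph $G$ is obtained from graphs $G_1$ and $G_2$ by \emph{gluing along at most $k$ vertices} if $G_1[V(G_1)\cap V(G_2)] = G_2[V(G_1)\cap V(G_2)]$, $|V(G_1)\cap V(G_2)| \le k$ and $G = G_1 \cup G_2$. For a class $\mathcal{G}$ of graphs and a positive integer $k$, the \emph{$k$-closure} $\mathcal{G}^k$ is the smallest class of graphs that includes $\mathcal{G}$ and is closed under gluing along at most $k$ vertices. For a positive integer $k$, define $\psi_c(k)$, $\psi(k)$ and $\varphi(k)$ as follows. \begin{itemize} \item $\psi_c(k)$ is the smallest integer $c \ge 0$ such that every graph $G$ is $(k+1)$-connected, or admits a cut-partition $(A,B,C)$ such that $G[A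 \cup C]$ is $(k+1)$-connected and $|C| \le c$, or has a vertex of degree at most $c$. \item $\psi(k)$ is the smallest integer $c \ge 0$ such that for every hereditary class $\mathcal{G}$ and every graph $G \in \mathcal{G}^k$, either $G \in \mathcal{G}$, or $G$ admits a cut-partition $(A,B,C)$ such that $G[A \cup C] \in \mathcal{G}$ and $|C| \le c$, or $G$ has a vertex of degree at most $c$. \item $\varphi(k)$ is the smallest integer $c \ge 0$ such that for every hereditary class $\mathcal{G}$ and every graph $G \in \mathcal{G}^k$, either $G \in \mathcal{G}$, or $G$ admits a cut-partition $(A,B,C)$ such that $G[A] \in \mathcal{G}$ and $|C| \le c$. \end{itemize} \textbf{Theorem.} For every positive integer $k$, these three minima exist, and all of the following hold: \begin{itemize} \item[(1)] $2k-1 \le \varphi(k) \le \psi(k) \le \psi_c(k) \le 2k^2-1$; \item[(2)] $k^2+k-1 \le \psi(k) \le \psi_c(k) \le 2k^2-1$; \item[(3)] $\frac14 k \log_2 k < \varphi(k) \le 2k^2-1$. \end{itemize} Furthermore, \begin{itemize} \item[(4)] $\varphi(2) = \psi(2) = \psi_c(2) = 5$. \end{itemize} -/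

import Mathlib

/-- A finite, simple, non-null graph. The vertex set lies in `Type`; every finite graph is
isomorphic to one of this kind, and all notions below are invariant under isomorphism. -/
structure FinGraph where
  /-- the vertex set -/
  V : Type
  finite : Finite V
  nonempty : Nonempty V
  /-- the adjacency relation -/
  graph : SimpleGraph V

namespace FinGraph

/-- The subgraph `G[S]` induced on a non-empty set `S` of vertices. -/
def induce (G : FinGraph) (S : Set G.V) (hS : S.Nonempty) : FinGraph where
  V := S
  finite := haveI := G.finite; inferInstance
  nonempty := hS.to_subtype
  graph := G.graph.induce S

/-- `C` is a cutset of `G`: deleting `C` leaves a disconnected graph, that is, one in which some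
two vertices are not joined by a path. (So the null graph does not count as disconnected.) -/
def IsCutset (G : FinGraph) (C : Set G.V) : Prop :=
  ¬ (G.graph.induce Cᶜ).Preconnected

/-- `G` is `k`-connected: it has at least `k + 1` vertices and no cutset of fewer than `k`
vertices. -/
def IsKConnected (k : ℕ) (G : FinGraph) : Prop :=
  k + 1 ≤ Nat.card G.V ∧ ¬ ∃ C : Set G.V, G.IsCutset C ∧ C.ncard < k

/-- `(A, B, C)` is a cut-partition of `G`: a partition of the vertex set (`C` may be empty) with
`A`, `B` non-empty and no edge between `A` and `B`. -/
structure IsCutPartition (G : FinGraph) (A B C : Set G.V) : Prop where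
  nonempty_left : A.Nonempty
  nonempty_right : B.Nonempty
  disjoint_left_right : Disjoint A B
  disjoint_left_cut : Disjoint A C
  disjoint_right_cut : Disjoint B C
  union_eq : A ∪ B ∪ C = Set.univ
  anticomplete : ∀ a ∈ A, ∀ b ∈ B, ¬ G.graph.Adj a b

/-- The degree of a vertex. -/
noncomputable def deg (G : FinGraph) (v : G.V) : ℕ := (G.graph.neighborSet v).ncard

/-- A class of graphs is hereditary if it is closed under isomorphism and under taking
(non-null) induced subgraphs. -/
structure Hereditary (𝒢 : Set FinGraph) : Prop where
  iso : ∀ G H : FinGraph, G ∈ 𝒢 → Nonempty (G.graph ≃g H.graph) → H ∈ 𝒢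
  induce : ∀ (G : FinGraph) (S : Set G.V) (hS : S.Nonempty), G ∈ 𝒢 → G.induce S hS ∈ 𝒢

/-- `G` is obtained from `G₁` and `G₂` by gluing along at most `k` vertices. The injections `f₁`
and `f₂` identify `V(G₁)` and `V(G₂)` with subsets of `V(G)`; under this identification
`V(G₁) ∩ V(G₂)` has at most `k` elements and induces the same graph in `G₁` as in `G₂`, and
`G = G₁ ∪ G₂`. -/
def IsGluing (k : ℕ) (G₁ G₂ G : FinGraph) : Prop :=
  ∃ (f₁ : G₁.V ↪ G.V) (f₂ : G₂.V ↪ G.V),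
    (G₁.graph.map f₁).induce (Set.range f₁ ∩ Set.range f₂)
      = (G₂.graph.map f₂).induce (Set.range f₁ ∩ Set.range f₂) ∧
    (Set.range f₁ ∩ Set.range f₂).ncard ≤ k ∧
    Set.range f₁ ∪ Set.range f₂ = Set.univ ∧
    G.graph = G₁.graph.map f₁ ⊔ G₂.graph.map f₂

/-- The `k`-closure of a class `𝒢`: the smallest class that includes `𝒢` and is closed under
gluing along at most `k` vertices. -/
inductive KClosure (k : ℕ) (𝒢 : Set FinGraph) : FinGraph → Prop
  | basic (G : FinGraph) : G ∈ 𝒢 → KClosure k 𝒢 G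
  | glue (G₁ G₂ G : FinGraph) :
      KClosure k 𝒢 G₁ → KClosure k 𝒢 G₂ → IsGluing k G₁ G₂ G → KClosure k 𝒢 G

/-- `c` is an admissible value for `ψ_c(k)`. -/
def PsiCBound (k c : ℕ) : Prop :=
  ∀ G : FinGraph,
    G.IsKConnected (k + 1) ∨
    (∃ (A B C : Set G.V) (h : G.IsCutPartition A B C),
      (G.induce (A ∪ C) h.nonempty_left.inl).IsKConnected (k + 1) ∧ C.ncard ≤ c) ∨
    ∃ v : G.V, G.deg v ≤ c

/-- `c` is an admissible value for `ψ(k)`. -/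
def PsiBound (k c : ℕ) : Prop :=
  ∀ 𝒢 : Set FinGraph, Hereditary 𝒢 → ∀ G : FinGraph, KClosure k 𝒢 G →
    G ∈ 𝒢 ∨
    (∃ (A B C : Set G.V) (h : G.IsCutPartition A B C),
      G.induce (A ∪ C) h.nonempty_left.inl ∈ 𝒢 ∧ C.ncard ≤ c) ∨
    ∃ v : G.V, G.deg v ≤ c

/-- `c` is an admissible value for `φ(k)`. -/
def PhiBound (k c : ℕ) : Prop :=
  ∀ 𝒢 : Set FinGraph, Hereditary 𝒢 → ∀ G : FinGraph, KClosure k 𝒢 G →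
    G ∈ 𝒢 ∨
    ∃ (A B C : Set G.V) (h : G.IsCutPartition A B C),
      G.induce A h.nonempty_left ∈ 𝒢 ∧ C.ncard ≤ c

/-- `ψ_c(k)`, the smallest admissible value. -/
noncomputable def psiC (k : ℕ) : ℕ := sInf {c | PsiCBound k c}

/-- `ψ(k)`, the smallest admissible value. -/
noncomputable def psi (k : ℕ) : ℕ := sInf {c | PsiBound k c}

/-- `φ(k)`, the smallest admissible value. -/
noncomputable def phi (k : ℕ) : ℕ := sInf {c | PhiBound k c}

end FinGraph

/-! The chain φ ≤ ψ ≤ ψ_c compares admissible values. A graph with no cutset of at most k vertices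
cannot be spread over both sides of a gluing, so if it embeds in a member of the k-closure it
already lies in the class (`KClosure.mem_of_embedding`). Hence a value admissible for ψ_c is
admissible for ψ. A vertex of small degree is cut off by its neighbourhood, or else the graph is
tiny, so a value admissible for ψ is admissible for φ.

Upper bounds come from discharging. Splitting repeatedly along exactly k vertices yields parts that
have at most k + 1 vertices or are (k+1)-connected, and the excesses max(1, |Y| - k) of the parts
add up to no more than that of the whole graph (`exists_isDecomposition`). In a counterexample to c,
every part that has at least k + 2 vertices and an interior vertex has more than c boundary
vertices. If the excess of each part can be distributed over its vertices so that every vertex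
receives at least 1, then |V| ≤ |V| - k, a contradiction (`PsiCBound.of_weights`). A uniform rule
gives c = 2k² - 1; for k = 2 a finer rule on five-vertex parts gives c = 5.

Lower bounds use the class of all graphs with at most m + q vertices. The graphs consist of pieces,
each a clique of q vertices (its hub) joined to the ports of the piece, with a sparse graph on the
ports of all pieces and some free ports. Large hubs make it too costly to meet two pieces, so only
the port graph matters. For φ, a matching of c edges leaving each piece and c suitable neighbours at
each free port suffice (`le_of_phiBound_of_pieces`); for ψ, all m ports of some piece, or m
neighbours of a free port, are forced into C (`le_of_psiBound_of_pieces`). It remains to find port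
graphs that can be assembled by gluing along k vertices (`Buildable`): a cube for the logarithmic
bound, a tower for k² + k - 1 and 2k - 1, and storeys of triads for φ(2) ≥ 5. The case k = 1 is a
three-vertex path. -/

namespace FinGraph

/-! ### The k-closure of a hereditary class, and the comparison of the three bounds -/

/-- The `k`-closure of a hereditary class is closed under isomorphism. -/
theorem KClosure.of_iso {k : ℕ} {𝒢 : Set FinGraph} (h𝒢 : Hereditary 𝒢) {G H : FinGraph}
    (hG : KClosure k 𝒢 G) (e : G.graph ≃g H.graph) : KClosure k 𝒢 H := by
  cases hG with
  | basic _ h => exact .basic _ (h𝒢.iso _ _ h ⟨e⟩)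
  | glue G₁ G₂ _ h₁ h₂ h =>
    obtain ⟨f₁, f₂, hind, hcard, huniv, hG⟩ := h
    refine .glue G₁ G₂ _ h₁ h₂
      ⟨f₁.trans e.toEquiv.toEmbedding, f₂.trans e.toEquiv.toEmbedding, ?_, ?_, ?_, ?_⟩
    · ext ⟨x, hx₁, hx₂⟩ ⟨y, hy₁, hy₂⟩
      obtain ⟨x', rfl⟩ := e.surjective x
      obtain ⟨y', rfl⟩ := e.surjective y
      have hx₁' : x' ∈ Set.range f₁ := by
        obtain ⟨a, ha⟩ := hx₁; exact ⟨a, e.injective ha⟩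
      have hx₂' : x' ∈ Set.range f₂ := by
        obtain ⟨a, ha⟩ := hx₂; exact ⟨a, e.injective ha⟩
      have hy₁' : y' ∈ Set.range f₁ := by
        obtain ⟨a, ha⟩ := hy₁; exact ⟨a, e.injective ha⟩
      have hy₂' : y' ∈ Set.range f₂ := by
        obtain ⟨a, ha⟩ := hy₂; exact ⟨a, e.injective ha⟩
      have := congrArg (fun K => K.Adj ⟨x', hx₁', hx₂'⟩ ⟨y', hy₁', hy₂'⟩) hind
      simpa [SimpleGraph.map_adj] using this
    · have : Set.range (f₁.trans e.toEquiv.toEmbedding) ∩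
          Set.range (f₂.trans e.toEquiv.toEmbedding) =
          e '' (Set.range f₁ ∩ Set.range f₂) := by
        rw [Set.image_inter e.injective, ← Set.range_comp, ← Set.range_comp]; rfl
      rw [this, Set.ncard_image_of_injective _ e.injective]
      exact hcard
    · have : Set.range (f₁.trans e.toEquiv.toEmbedding) ∪
          Set.range (f₂.trans e.toEquiv.toEmbedding) =
          e '' (Set.range f₁ ∪ Set.range f₂) := by
        rw [Set.image_union, ← Set.range_comp, ← Set.range_comp]; rfl
      rw [this, huniv, Set.image_univ, e.surjective.range_eq]
    · ext x y
      obtain ⟨x', rfl⟩ := e.surjective x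
      obtain ⟨y', rfl⟩ := e.surjective y
      have := congrArg (fun K => K.Adj x' y') hG
      rw [e.map_adj_iff]
      simpa [SimpleGraph.map_adj] using this

theorem KClosure.exists_mem {k : ℕ} {𝒢 : Set FinGraph} {G : FinGraph}
    (hG : KClosure k 𝒢 G) : ∃ H, H ∈ 𝒢 := by
  induction hG with
  | basic G h => exact ⟨G, h⟩
  | glue _ _ _ _ _ _ ih _ => exact ih

/-- A graph without cutsets of size at most `k` that embeds into a graph of the `k`-closure of a
hereditary class belongs to the class. -/
theorem KClosure.mem_of_embedding {k : ℕ} {𝒢 : Set FinGraph} (h𝒢 : Hereditary 𝒢) {G : FinGraph}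
    (hG : KClosure k 𝒢 G) (H : FinGraph) (hH : ¬ ∃ C : Set H.V, H.IsCutset C ∧ C.ncard < k + 1)
    (e : H.graph ↪g G.graph) : H ∈ 𝒢 := by
  induction hG with
  | basic G h =>
    have hne : (Set.range e).Nonempty := by
      obtain ⟨v⟩ := H.nonempty; exact ⟨_, v, rfl⟩
    refine h𝒢.iso _ _ (h𝒢.induce G (Set.range e) hne h) ⟨?_⟩
    exact (SimpleGraph.Embedding.isoInduceRange e).symm
  | glue G₁ G₂ G h₁ h₂ h ih₁ ih₂ =>
    obtain ⟨f₁, f₂, hind, hcard, huniv, hGe⟩ := h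
    have hadj : ∀ x y, G.graph.Adj x y ↔
        (G₁.graph.map f₁).Adj x y ∨ (G₂.graph.map f₂).Adj x y := by
      intro x y; rw [hGe]; rfl
    have hboth : ∀ x y, x ∈ Set.range f₁ ∩ Set.range f₂ → y ∈ Set.range f₁ ∩ Set.range f₂ →
        ((G₁.graph.map f₁).Adj x y ↔ (G₂.graph.map f₂).Adj x y) := by
      intro x y hx hy
      have := congrArg (fun K => K.Adj ⟨x, hx⟩ ⟨y, hy⟩) hind
      simpa using this
    have hrange₁ : ∀ x y, (G₁.graph.map f₁).Adj x y → x ∈ Set.range f₁ ∧ y ∈ Set.range f₁ := by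
      rintro x y ⟨-, a, b, -, rfl, rfl⟩; exact ⟨⟨a, rfl⟩, ⟨b, rfl⟩⟩
    have hrange₂ : ∀ x y, (G₂.graph.map f₂).Adj x y → x ∈ Set.range f₂ ∧ y ∈ Set.range f₂ := by
      rintro x y ⟨-, a, b, -, rfl, rfl⟩; exact ⟨⟨a, rfl⟩, ⟨b, rfl⟩⟩
    by_cases hs₁ : ∀ x, e x ∈ Set.range f₁
    · choose g hg using hs₁
      have ginj : Function.Injective g := by
        intro a b hab
        apply e.injective; rw [← hg a, ← hg b, hab]
      refine ih₁ ⟨⟨g, ginj⟩, ?_⟩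
      intro a b
      rw [← e.map_adj_iff, hadj]
      simp only [Function.Embedding.coeFn_mk]
      have h1 : (G₁.graph.map f₁).Adj (e a) (e b) ↔ G₁.graph.Adj (g a) (g b) := by
        rw [← hg a, ← hg b, SimpleGraph.map_adj_apply]
      rw [← h1]
      constructor
      · exact Or.inl
      · rintro (h | h)
        · exact h
        · obtain ⟨ha, hb⟩ := hrange₂ _ _ h
          exact (hboth _ _ ⟨⟨_, hg a⟩, ha⟩ ⟨⟨_, hg b⟩, hb⟩).2 h
    by_cases hs₂ : ∀ x, e x ∈ Set.range f₂
    · choose g hg using hs₂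
      have ginj : Function.Injective g := by
        intro a b hab
        apply e.injective; rw [← hg a, ← hg b, hab]
      refine ih₂ ⟨⟨g, ginj⟩, ?_⟩
      intro a b
      rw [← e.map_adj_iff, hadj]
      simp only [Function.Embedding.coeFn_mk]
      have h1 : (G₂.graph.map f₂).Adj (e a) (e b) ↔ G₂.graph.Adj (g a) (g b) := by
        rw [← hg a, ← hg b, SimpleGraph.map_adj_apply]
      rw [← h1]
      constructor
      · exact Or.inr
      · rintro (h | h)
        · obtain ⟨ha, hb⟩ := hrange₁ _ _ h
          exact (hboth _ _ ⟨ha, ⟨_, hg a⟩⟩ ⟨hb, ⟨_, hg b⟩⟩).1 h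
        · exact h
    exfalso
    push Not at hs₁ hs₂
    obtain ⟨u, hu⟩ := hs₁
    obtain ⟨v, hv⟩ := hs₂
    apply hH
    -- If `H` lies in neither side, the trace of the overlap is a cutset: every edge of `G` lies in
    -- one side, so a walk from outside the first side can enter it only through the overlap.
    refine ⟨e ⁻¹' (Set.range f₁ ∩ Set.range f₂), ?_, ?_⟩
    · intro hpre
      obtain ⟨p⟩ := hpre ⟨u, fun h => hu h.1⟩ ⟨v, fun h => hv h.2⟩
      have key : ∀ (a b : ((e ⁻¹' (Set.range f₁ ∩ Set.range f₂))ᶜ : Set H.V)),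
          (H.graph.induce (e ⁻¹' (Set.range f₁ ∩ Set.range f₂))ᶜ).Walk a b →
          e a ∉ Set.range f₁ → e b ∉ Set.range f₁ := by
        intro a b q
        induction q with
        | nil => exact id
        | @cons a c b hac q ih =>
          intro ha
          apply ih
          have h' : G.graph.Adj (e a) (e c) := e.map_adj_iff.2 hac
          rw [hadj] at h'
          rcases h' with h' | h'
          · exact absurd (hrange₁ _ _ h').1 ha
          · intro hc; exact c.2 ⟨hc, (hrange₂ _ _ h').2⟩
      have := key _ _ p hu
      have hv' : e v ∈ Set.range f₁ ∪ Set.range f₂ := huniv ▸ Set.mem_univ _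
      rcases hv' with h | h
      · exact this h
      · exact hv h
    · have := G.finite
      have := Set.ncard_le_ncard_of_injOn (s := e ⁻¹' (Set.range f₁ ∩ Set.range f₂))
        (t := Set.range f₁ ∩ Set.range f₂) e (fun a ha => ha) e.injective.injOn (Set.toFinite _)
      omega

theorem PsiBound.of_psiCBound {k c : ℕ} (h : PsiCBound k c) : PsiBound k c := by
  intro 𝒢 h𝒢 G hG
  rcases h G with h | ⟨A, B, C, hp, hc, hC⟩ | h
  · exact Or.inl (hG.mem_of_embedding h𝒢 G h.2 (SimpleGraph.Embedding.refl))
  · exact Or.inr (Or.inl ⟨A, B, C, hp,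
      hG.mem_of_embedding h𝒢 _ hc.2 (SimpleGraph.Embedding.induce _), hC⟩)
  · exact Or.inr (Or.inr h)

theorem Hereditary.induce_subset {𝒢 : Set FinGraph} (h𝒢 : Hereditary 𝒢) {G : FinGraph}
    {S T : Set G.V} (hS : S.Nonempty) (hT : T.Nonempty) (hST : S ⊆ T)
    (h : G.induce T hT ∈ 𝒢) : G.induce S hS ∈ 𝒢 := by
  have hne : {x : (G.induce T hT).V | x.1 ∈ S}.Nonempty := by
    obtain ⟨s, hs⟩ := hS; exact ⟨⟨s, hST hs⟩, hs⟩
  refine h𝒢.iso _ _ (h𝒢.induce _ {x : (G.induce T hT).V | x.1 ∈ S} hne h) ⟨?_⟩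
  exact
    { toFun := fun x => ⟨x.1.1, x.2⟩
      invFun := fun x => ⟨⟨x.1, hST x.2⟩, x.2⟩
      left_inv := fun x => rfl
      right_inv := fun x => rfl
      map_rel_iff' := Iff.rfl }

/-- One-vertex graphs belong to every hereditary class with non-empty closure. -/
theorem KClosure.singleton_mem {k : ℕ} {𝒢 : Set FinGraph} (h𝒢 : Hereditary 𝒢) {G : FinGraph}
    (hG : KClosure k 𝒢 G) (v : G.V) : G.induce {v} (Set.singleton_nonempty v) ∈ 𝒢 := by
  obtain ⟨H, hH⟩ := hG.exists_mem
  obtain ⟨w⟩ := H.nonempty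
  refine h𝒢.iso _ _ (h𝒢.induce H {w} (Set.singleton_nonempty w) hH) ⟨?_⟩
  exact
    { toFun := fun _ => ⟨v, rfl⟩
      invFun := fun _ => ⟨w, rfl⟩
      left_inv := fun x => Subtype.ext x.2.symm
      right_inv := fun x => Subtype.ext x.2.symm
      map_rel_iff' := by
        rintro ⟨a, rfl⟩ ⟨b, rfl⟩
        simp [FinGraph.induce] }

/-- Only the low-degree outcome needs work. If `v` has a non-neighbour, its neighbourhood separates
the single vertex `v` from the rest. Otherwise `G` has at most `c + 1` vertices, and it is either
complete, so already in the class, or has two non-adjacent vertices separated by all the others. -/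
theorem PhiBound.of_psiBound {k c : ℕ} (h : PsiBound k c) : PhiBound k c := by
  intro 𝒢 h𝒢 G hG
  have := G.finite
  rcases h 𝒢 h𝒢 G hG with h | ⟨A, B, C, hp, hc, hC⟩ | ⟨v, hv⟩
  · exact Or.inl h
  · exact Or.inr ⟨A, B, C, hp, h𝒢.induce_subset _ _ Set.subset_union_left hc, hC⟩
  by_cases hB : ∃ w, w ≠ v ∧ ¬ G.graph.Adj v w
  · obtain ⟨w, hwv, hw⟩ := hB
    refine Or.inr ⟨{v}, {x | x ≠ v ∧ ¬ G.graph.Adj v x}, G.graph.neighborSet v, ?_,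
      hG.singleton_mem h𝒢 v, hv⟩
    refine ⟨⟨v, rfl⟩, ⟨w, hwv, hw⟩, ?_, ?_, ?_, ?_, ?_⟩
    · simp
    · simp
    · rw [Set.disjoint_left]; rintro x ⟨-, hx⟩ hx'; exact hx hx'
    · ext x
      by_cases h1 : x = v <;> by_cases h2 : G.graph.Adj v x <;> simp [h1, h2]
    · rintro a rfl b hb; exact hb.2
  push Not at hB
  have hcard : Nat.card G.V ≤ c + 1 := by
    have h1 : insert v (G.graph.neighborSet v) = Set.univ := by
      ext x
      by_cases h1 : x = v
      · simp [h1]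
      · simp [hB x h1]
    have h2 := Set.ncard_insert_le v (G.graph.neighborSet v)
    rw [h1, Set.ncard_univ] at h2
    unfold deg at hv
    omega
  by_cases hcomp : ∀ x y, x ≠ y → G.graph.Adj x y
  · refine Or.inl (hG.mem_of_embedding h𝒢 G ?_ SimpleGraph.Embedding.refl)
    rintro ⟨C, hC, -⟩
    apply hC
    intro x y
    by_cases hxy : x = y
    · rw [hxy]
    · exact SimpleGraph.Adj.reachable (hcomp x.1 y.1 (fun h => hxy (Subtype.ext h)))
  push Not at hcomp
  obtain ⟨x, y, hxy, hnadj⟩ := hcomp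
  refine Or.inr ⟨{x}, {y}, {x, y}ᶜ, ?_, hG.singleton_mem h𝒢 x, ?_⟩
  · refine ⟨⟨x, rfl⟩, ⟨y, rfl⟩, ?_, ?_, ?_, ?_, ?_⟩
    · simpa using hxy
    · simp
    · simp
    · ext z
      by_cases h1 : z = x <;> by_cases h2 : z = y <;> simp [h1, h2]
    · rintro a rfl b rfl; exact hnadj
  · rw [Set.ncard_compl, Set.ncard_pair hxy]; omega

end FinGraph

/-! ### Decompositions along k vertices -/

namespace FinGraph

open Finset

open Classical in
/-- A set of at least `k + 2` vertices that does not induce a `(k + 1)`-connected graph splits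
into two proper subsets along exactly `k` vertices. -/
theorem exists_split (G : FinGraph) {k : ℕ} (X : Finset G.V) (hX : (X : Set G.V).Nonempty)
    (hk : k + 2 ≤ #X) (hn : ¬ (G.induce X hX).IsKConnected (k + 1)) :
    ∃ S T : Finset G.V, S ∪ T = X ∧ S ⊂ X ∧ T ⊂ X ∧ #(S ∩ T) = k ∧
      ∀ u ∈ S, u ∉ T → ∀ v ∈ T, v ∉ S → ¬ G.graph.Adj u v := by
  -- A separation of order below `k` is brought to order exactly `k`, with `n` the deficit: a side
  -- with two private vertices can lend one of them to the other side and stay non-trivial.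
  have enlarge : ∀ n : ℕ, ∀ S T : Finset G.V, S ∪ T = X → S ⊂ X → T ⊂ X → #(S ∩ T) + n = k →
      (∀ u ∈ S, u ∉ T → ∀ v ∈ T, v ∉ S → ¬ G.graph.Adj u v) →
      ∃ S T : Finset G.V, S ∪ T = X ∧ S ⊂ X ∧ T ⊂ X ∧ #(S ∩ T) = k ∧
        ∀ u ∈ S, u ∉ T → ∀ v ∈ T, v ∉ S → ¬ G.graph.Adj u v := by
    intro n
    induction n with
    | zero => intro S T h1 h2 h3 h4 h5; exact ⟨S, T, h1, h2, h3, h4, h5⟩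
    | succ n ih =>
      have step : ∀ S T : Finset G.V, S ∪ T = X → S ⊂ X → T ⊂ X → #(S ∩ T) + (n + 1) = k →
          (∀ u ∈ S, u ∉ T → ∀ v ∈ T, v ∉ S → ¬ G.graph.Adj u v) → 2 ≤ #(S \ T) →
          ∃ S T : Finset G.V, S ∪ T = X ∧ S ⊂ X ∧ T ⊂ X ∧ #(S ∩ T) = k ∧
            ∀ u ∈ S, u ∉ T → ∀ v ∈ T, v ∉ S → ¬ G.graph.Adj u v := by
        intro S T h1 h2 h3 h4 h5 h6
        obtain ⟨a, ha, b, hb, hab⟩ := Finset.one_lt_card.1 h6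
        rw [mem_sdiff] at ha hb
        refine ih S (insert a T) ?_ h2 ?_ ?_ ?_
        · rw [union_insert, h1, insert_eq_self]; exact h2.subset ha.1
        · refine ⟨insert_subset (h2.subset ha.1) h3.subset, fun h => ?_⟩
          have := h (h2.subset hb.1)
          rw [mem_insert] at this
          rcases this with h | h
          · exact hab h.symm
          · exact hb.2 h
        · rw [inter_insert_of_mem ha.1, card_insert_of_notMem (by simp [ha.2])]; omega
        · intro u hu hu' v hv hv'
          rw [mem_insert, not_or] at hu'
          rw [mem_insert] at hv
          rcases hv with rfl | hv
          · exact absurd ha.1 hv'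
          · exact h5 u hu hu'.2 v hv hv'
      intro S T h1 h2 h3 h4 h5
      by_cases h6 : 2 ≤ #(S \ T)
      · exact step S T h1 h2 h3 h4 h5 h6
      -- Since `X` has at least `k + 2` vertices and the overlap fewer than `k`, at least three
      -- vertices are private, so one of the sides has two.
      · refine step T S (by rw [union_comm, h1]) h3 h2 (by rw [inter_comm]; exact h4)
          (fun u hu hu' v hv hv' h => h5 v hv hv' u hu hu' h.symm) ?_
        have e1 := card_sdiff_add_card_inter S T
        have e2 := card_sdiff_add_card_inter T S
        have e3 := card_union_add_card_inter S T
        rw [h1] at e3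
        rw [inter_comm] at e2
        omega
  have hcard : Nat.card (G.induce X hX).V = #X := by
    change Nat.card X = #X
    simp
  unfold IsKConnected at hn
  rw [hcard, not_and_not_right] at hn
  obtain ⟨C, hC, hCk⟩ := hn (by omega)
  unfold IsCutset SimpleGraph.Preconnected at hC
  push Not at hC
  obtain ⟨u, v, huv⟩ := hC
  set K := (G.induce X hX).graph.induce Cᶜ with hK
  -- The component of `u` after deleting the cutset. The two sides will be this component with the
  -- cutset, and the complement of the component.
  let A : Set G.V := {w | ∃ (hw : w ∈ X) (hc : (⟨w, hw⟩ : (G.induce X hX).V) ∈ Cᶜ),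
    K.Reachable u ⟨⟨w, hw⟩, hc⟩}
  let C' : Set G.V := {w | ∃ hw : w ∈ X, (⟨w, hw⟩ : (G.induce X hX).V) ∈ C}
  have hAC : ∀ w, w ∈ A → w ∉ C' := by
    rintro w ⟨_, hc, _⟩ ⟨_, hc'⟩; exact hc hc'
  have huA : u.1.1 ∈ A := ⟨u.1.2, u.2, .rfl⟩
  have hvA : v.1.1 ∉ A := by
    rintro ⟨_, _, h⟩; exact huv h
  have hvC : v.1.1 ∉ C' := by
    rintro ⟨_, h⟩; exact v.2 h
  let f : (G.induce X hX).V → G.V := fun x => x.1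
  have hf : Function.Injective f := fun a b h => Subtype.ext h
  have hle : #(X.filter (fun w => w ∈ A ∨ w ∈ C') ∩ X.filter (fun w => w ∉ A)) ≤ k := by
    have h1 : ((X.filter (fun w => w ∈ A ∨ w ∈ C') ∩ X.filter (fun w => w ∉ A) : Finset G.V) :
        Set G.V) ⊆ f '' C := by
      intro w hw
      simp only [coe_inter, coe_filter, Set.mem_inter_iff, Set.mem_ofPred_eq] at hw
      rcases hw.1.2 with h | h
      · exact absurd h hw.2.2
      · obtain ⟨hw', hc⟩ := h
        exact ⟨_, hc, rfl⟩
    have := (G.induce X hX).finite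
    have h2 := Set.ncard_le_ncard h1 ((Set.toFinite C).image f)
    rw [Set.ncard_coe_finset, Set.ncard_image_of_injective _ hf] at h2
    omega
  obtain ⟨n, hn⟩ := Nat.exists_eq_add_of_le hle
  refine enlarge n (X.filter (fun w => w ∈ A ∨ w ∈ C')) (X.filter (fun w => w ∉ A)) ?_ ?_ ?_
    hn.symm ?_
  · ext w
    by_cases h : w ∈ A <;> simp [h]
    tauto
  · refine ⟨filter_subset _ _, fun h => ?_⟩
    have := (mem_filter.1 (h v.1.2)).2
    exact this.elim hvA hvC
  · refine ⟨filter_subset _ _, fun h => ?_⟩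
    exact (mem_filter.1 (h u.1.2)).2 huA
  · intro a ha ha' b hb hb' hab
    rw [mem_filter] at ha hb ha' hb'
    have haA : a ∈ A := by by_contra h; exact ha' ⟨ha.1, h⟩
    have hbC : b ∉ C' := fun h => hb' ⟨hb.1, Or.inr h⟩
    obtain ⟨h1, h2, h3⟩ := haA
    refine hb.2 ⟨hb.1, fun h => hbC ⟨hb.1, h⟩, h3.trans ?_⟩
    apply SimpleGraph.Adj.reachable
    exact hab

/-- The number `max 1 (|Y| - k)`, which is superadditive when a set is split along `k`
vertices. -/
def excess {α : Type} (k : ℕ) (Y : Finset α) : ℕ := max 1 (#Y - k)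

/-- A decomposition of the vertex set `X` into parts that are small or `(k + 1)`-connected, as
obtained by repeatedly splitting along `k` vertices. -/
structure IsDecomposition (G : FinGraph) (k : ℕ) (X : Finset G.V) {ι : Type} [Fintype ι]
    (Y : ι → Finset G.V) : Prop where
  nonempty : ∀ i, (Y i : Set G.V).Nonempty
  small_or_connected : ∀ i, #(Y i) ≤ k + 1 ∨ (G.induce (Y i) (nonempty i)).IsKConnected (k + 1)
  cover : ∀ v ∈ X, ∃ i, v ∈ Y i
  cover_adj : ∀ u ∈ X, ∀ v ∈ X, G.graph.Adj u v → ∃ i, u ∈ Y i ∧ v ∈ Y i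
  sum_excess_le : ∑ i, excess k (Y i) ≤ excess k X
  shared : ∀ i, Y i = X ∨ ∃ U ⊆ Y i, #U = k ∧
    ∀ u ∈ U, ∀ v ∈ U, G.graph.Adj u v → ∃ j, j ≠ i ∧ u ∈ Y j ∧ v ∈ Y j

theorem IsDecomposition.singleton (G : FinGraph) {k : ℕ} (X : Finset G.V)
    (hX : (X : Set G.V).Nonempty)
    (h : #X ≤ k + 1 ∨ (G.induce X hX).IsKConnected (k + 1)) :
    G.IsDecomposition k X (fun _ : Unit => X) where
  nonempty _ := hX
  small_or_connected _ := h
  cover v hv := ⟨(), hv⟩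
  cover_adj u hu v hv _ := ⟨(), hu, hv⟩
  sum_excess_le := by simp
  shared _ := Or.inl rfl

open Classical in
-- Both sides have more than `k` vertices, so their excesses are |S| - k and |T| - k, with sum |X| -
-- k. For `shared`, a part equal to a whole side takes U = S ∩ T, whose edges are covered again by
-- the decomposition of the other side; any other part keeps the set it had.
theorem IsDecomposition.glue {G : FinGraph} {k : ℕ} {X S T : Finset G.V} (hST : S ∪ T = X)
    (hSX : S ⊂ X) (hTX : T ⊂ X) (hk : #(S ∩ T) = k) (hX : k + 2 ≤ #X)
    (hadj : ∀ u ∈ S, u ∉ T → ∀ v ∈ T, v ∉ S → ¬ G.graph.Adj u v)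
    {ι κ : Type} [Fintype ι] [Fintype κ] {Y : ι → Finset G.V} {Z : κ → Finset G.V}
    (hY : G.IsDecomposition k S Y) (hZ : G.IsDecomposition k T Z) :
    G.IsDecomposition k X (Sum.elim Y Z) where
  nonempty := by rintro (i | i); exacts [hY.nonempty i, hZ.nonempty i]
  small_or_connected := by
    rintro (i | i); exacts [hY.small_or_connected i, hZ.small_or_connected i]
  cover v hv := by
    rw [← hST, mem_union] at hv
    rcases hv with h | h
    · obtain ⟨i, hi⟩ := hY.cover v h; exact ⟨.inl i, hi⟩
    · obtain ⟨i, hi⟩ := hZ.cover v h; exact ⟨.inr i, hi⟩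
  cover_adj u hu v hv huv := by
    have hS : u ∈ S → v ∈ S → ∃ i, u ∈ Sum.elim Y Z i ∧ v ∈ Sum.elim Y Z i := by
      intro h1 h2
      obtain ⟨i, hi⟩ := hY.cover_adj u h1 v h2 huv; exact ⟨.inl i, hi⟩
    have hT : u ∈ T → v ∈ T → ∃ i, u ∈ Sum.elim Y Z i ∧ v ∈ Sum.elim Y Z i := by
      intro h1 h2
      obtain ⟨i, hi⟩ := hZ.cover_adj u h1 v h2 huv; exact ⟨.inr i, hi⟩
    rw [← hST, mem_union] at hu hv
    have h1 := hadj u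
    have h2 := hadj v
    have h3 := huv.symm
    by_cases a : u ∈ S <;> by_cases b : u ∈ T <;> by_cases c : v ∈ S <;> by_cases d : v ∈ T <;>
      simp_all
  sum_excess_le := by
    rw [Fintype.sum_sum_type]
    have h1 := hY.sum_excess_le
    have h2 := hZ.sum_excess_le
    simp only [Sum.elim_inl, Sum.elim_inr]
    have h3 := card_lt_card hSX
    have h4 := card_lt_card hTX
    have h5 := card_union_add_card_inter S T
    rw [hST, hk] at h5
    unfold excess at *
    omega
  shared := by
    have hSS : S ∩ T ⊆ S := inter_subset_left
    have hTT : S ∩ T ⊆ T := inter_subset_right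
    rintro (i | i)
    · right
      rcases hY.shared i with h | ⟨U, hU, hc, h⟩
      · refine ⟨S ∩ T, by simp [h], hk, fun u hu v hv huv => ?_⟩
        obtain ⟨j, hj⟩ := hZ.cover_adj u (hTT hu) v (hTT hv) huv
        exact ⟨.inr j, by simp, hj⟩
      · refine ⟨U, hU, hc, fun u hu v hv huv => ?_⟩
        obtain ⟨j, hji, hj⟩ := h u hu v hv huv
        exact ⟨.inl j, by simpa using hji, hj⟩
    · right
      rcases hZ.shared i with h | ⟨U, hU, hc, h⟩
      · refine ⟨S ∩ T, by simp [h], hk, fun u hu v hv huv => ?_⟩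
        obtain ⟨j, hj⟩ := hY.cover_adj u (hSS hu) v (hSS hv) huv
        exact ⟨.inl j, by simp, hj⟩
      · refine ⟨U, hU, hc, fun u hu v hv huv => ?_⟩
        obtain ⟨j, hji, hj⟩ := h u hu v hv huv
        exact ⟨.inr j, by simpa using hji, hj⟩

theorem exists_isDecomposition (G : FinGraph) (k : ℕ) (X : Finset G.V)
    (hX : (X : Set G.V).Nonempty) :
    ∃ (ι : Type) (_ : Fintype ι) (Y : ι → Finset G.V), G.IsDecomposition k X Y := by
  classical
  induction X using Finset.strongInduction with
  | H X ih =>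
    by_cases h : #X ≤ k + 1 ∨ (G.induce X hX).IsKConnected (k + 1)
    · exact ⟨Unit, inferInstance, _, IsDecomposition.singleton G X hX h⟩
    push Not at h
    obtain ⟨S, T, hST, hSX, hTX, hk, hadj⟩ := exists_split G X hX (by omega) h.2
    have hS : (S : Set G.V).Nonempty := by
      by_contra hS
      rw [Set.not_nonempty_iff_eq_empty, coe_eq_empty] at hS
      rw [hS, empty_union] at hST
      exact hTX.ne hST
    have hT : (T : Set G.V).Nonempty := by
      by_contra hT
      rw [Set.not_nonempty_iff_eq_empty, coe_eq_empty] at hT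
      rw [hT, union_empty] at hST
      exact hSX.ne hST
    obtain ⟨ι, _, Y, hY⟩ := ih S hSX hS
    obtain ⟨κ, _, Z, hZ⟩ := ih T hTX hT
    exact ⟨ι ⊕ κ, inferInstance, _, IsDecomposition.glue hST hSX hTX hk (by omega) hadj hY hZ⟩

end FinGraph

/-! ### Discharging and the bound 2k² - 1 -/

namespace FinGraph

open Finset

open Classical in
/-- The vertices of `Y` with a neighbour outside `Y`. -/
noncomputable def boundary (G : FinGraph) (Y : Finset G.V) : Finset G.V :=
  Y.filter (fun v => ∃ u, u ∉ Y ∧ G.graph.Adj v u)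

theorem mem_boundary {G : FinGraph} {Y : Finset G.V} {v : G.V} :
    v ∈ G.boundary Y ↔ v ∈ Y ∧ ∃ u, u ∉ Y ∧ G.graph.Adj v u := by
  simp [boundary]

theorem boundary_subset {G : FinGraph} (Y : Finset G.V) : G.boundary Y ⊆ Y :=
  fun _ h => (mem_boundary.1 h).1

theorem IsKConnected.congr {G : FinGraph} {k : ℕ} {S T : Set G.V} (h : S = T) (hS : S.Nonempty)
    (hT : T.Nonempty) (hc : (G.induce S hS).IsKConnected k) :
    (G.induce T hT).IsKConnected k := by
  subst h; exact hc

/-- A proper induced subgraph that is highly connected and has an interior vertex gives a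
cut-partition. -/
theorem exists_isCutPartition {G : FinGraph} {k : ℕ} {Y : Finset G.V}
    (hY : (Y : Set G.V).Nonempty) (hc : (G.induce Y hY).IsKConnected k)
    (huniv : ∃ u, u ∉ Y) (hint : ∃ v ∈ Y, v ∉ G.boundary Y) :
    ∃ (A B C : Set G.V) (h : G.IsCutPartition A B C),
      (G.induce (A ∪ C) h.nonempty_left.inl).IsKConnected k ∧ C.ncard ≤ #(G.boundary Y) := by
  obtain ⟨v, hv, hv'⟩ := hint
  have hcp : G.IsCutPartition {x | x ∈ Y ∧ x ∉ G.boundary Y} {x | x ∉ Y} (G.boundary Y) := by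
    refine ⟨⟨v, hv, hv'⟩, huniv, ?_, ?_, ?_, ?_, ?_⟩
    · rw [Set.disjoint_left]; exact fun x hx hx' => hx' hx.1
    · rw [Set.disjoint_left]; exact fun x hx hx' => hx.2 hx'
    · rw [Set.disjoint_left]; exact fun x hx hx' => hx (boundary_subset Y hx')
    · ext x
      by_cases h1 : x ∈ Y <;> by_cases h2 : x ∈ G.boundary Y <;> simp [h1, h2]
    · intro a ha b hb hab
      exact ha.2 (mem_boundary.2 ⟨ha.1, b, hb, hab⟩)
  refine ⟨_, _, _, hcp, hc.congr ?_ _ _, by rw [Set.ncard_coe_finset]⟩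
  ext x
  by_cases h : x ∈ G.boundary Y
  · simp [h, boundary_subset Y h]
  · simp [h]

theorem deg_eq_card {G : FinGraph} [Fintype G.V] [DecidableEq G.V] [DecidableRel G.graph.Adj]
    (v : G.V) : G.deg v = #(univ.filter (G.graph.Adj v)) := by
  rw [deg, ← Set.ncard_coe_finset]
  congr 1
  ext x; simp

/-- The discharging principle: a graph of large minimum degree in which no part of a
decomposition is isolated by a small boundary admits no weighting of the parts that gives every
vertex total weight at least one while respecting the excess of the parts. -/
theorem PsiCBound.of_weights {k c : ℕ} (hk : 0 < k) (hkc : k ≤ c)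
    (H : ∀ (G : FinGraph) [Fintype G.V] [DecidableEq G.V], (∀ v, c < G.deg v) →
      ∀ (ι : Type) [Fintype ι] (Y : ι → Finset G.V), G.IsDecomposition k univ Y →
        (∀ i, Y i ≠ univ) →
        (∀ i, k + 2 ≤ #(Y i) → (∃ v ∈ Y i, v ∉ G.boundary (Y i)) → c < #(G.boundary (Y i))) →
        ∃ w : ι → G.V → ℚ, (∀ i, ∑ v ∈ Y i, w i v ≤ (excess k (Y i) : ℚ)) ∧
          ∀ v, 1 ≤ ∑ i with v ∈ Y i, w i v) :
    PsiCBound k c := by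
  classical
  intro G
  have := G.finite
  have := Fintype.ofFinite G.V
  by_contra hcon
  push Not at hcon
  obtain ⟨h1, h2, h3⟩ := hcon
  obtain ⟨v₀⟩ := G.nonempty
  have hcard : k + 2 ≤ #(univ : Finset G.V) := by
    have h := h3 v₀
    rw [deg_eq_card] at h
    have h' : #(univ.filter (G.graph.Adj v₀)) < #(univ : Finset G.V) := by
      apply card_lt_card
      refine ⟨subset_univ _, fun h => ?_⟩
      have := h (mem_univ v₀)
      simp at this
    omega
  obtain ⟨ι, _, Y, hY⟩ := G.exists_isDecomposition k univ ⟨v₀, by simp⟩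
  have hne : ∀ i, Y i ≠ univ := by
    intro i hi
    rcases hY.small_or_connected i with h | h
    · rw [hi] at h; omega
    · apply h1
      refine ⟨by rw [Nat.card_eq_fintype_card, ← card_univ]; omega, ?_⟩
      rintro ⟨C, hC, hCk⟩
      apply h.2
      let e : (G.induce (Y i) (hY.nonempty i)).graph ≃g G.graph :=
        { toFun := fun x => x.1
          invFun := fun x => ⟨x, by rw [hi]; simp⟩
          left_inv := fun x => rfl
          right_inv := fun x => rfl
          map_rel_iff' := Iff.rfl }
      refine ⟨e ⁻¹' C, fun hp => hC ?_, ?_⟩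
      · intro x y
        have hx : e.symm x.1 ∈ (e ⁻¹' C)ᶜ := x.2
        have hy : e.symm y.1 ∈ (e ⁻¹' C)ᶜ := y.2
        have := hp ⟨_, hx⟩ ⟨_, hy⟩
        let f : (G.induce (Y i) (hY.nonempty i)).graph.induce (e ⁻¹' C)ᶜ →g G.graph.induce Cᶜ :=
          { toFun := fun z => ⟨e z.1, z.2⟩
            map_rel' := fun h => h }
        exact this.map f
      · have := Set.ncard_le_ncard_of_injOn (s := e ⁻¹' C) (t := C) e (fun a ha => ha)
          e.injective.injOn (Set.toFinite _)
        omega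
  have hbd : ∀ i, k + 2 ≤ #(Y i) → (∃ v ∈ Y i, v ∉ G.boundary (Y i)) →
      c < #(G.boundary (Y i)) := by
    intro i hi hint
    by_contra hlt
    rcases hY.small_or_connected i with h | h
    · omega
    obtain ⟨A, B, C, hp, hc, hC⟩ := exists_isCutPartition (hY.nonempty i) h (by
      by_contra hu
      push Not at hu
      exact hne i (eq_univ_iff_forall.2 hu)) hint
    exact absurd (h2 A B C hp hc) (by omega)
  obtain ⟨w, hw₁, hw₂⟩ := H G h3 ι Y hY hne hbd
  -- Double counting of the weights. The right side is at most |V| - k, which is smaller than |V|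
  -- because k > 0.
  have hsum : (#(univ : Finset G.V) : ℚ) ≤ ∑ i, (excess k (Y i) : ℚ) := by
    calc (#(univ : Finset G.V) : ℚ) = ∑ v : G.V, (1 : ℚ) := by simp
      _ ≤ ∑ v : G.V, ∑ i with v ∈ Y i, w i v := sum_le_sum fun v _ => hw₂ v
      _ = ∑ i, ∑ v ∈ Y i, w i v := by
          apply sum_comm'
          intro x y; simp
      _ ≤ _ := sum_le_sum fun i _ => hw₁ i
  have h4 := hY.sum_excess_le
  rw [← Nat.cast_sum, Nat.cast_le] at hsum
  have h5 : excess k (univ : Finset G.V) = #(univ : Finset G.V) - k := by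
    unfold excess; omega
  omega

theorem IsDecomposition.exists_other {G : FinGraph} {k : ℕ} [Fintype G.V] {ι : Type} [Fintype ι]
    {Y : ι → Finset G.V} (hY : G.IsDecomposition k univ Y) {i : ι} {v : G.V}
    (hv : v ∈ G.boundary (Y i)) : ∃ j, j ≠ i ∧ v ∈ Y j := by
  obtain ⟨-, u, hu, huv⟩ := mem_boundary.1 hv
  obtain ⟨j, hj, hj'⟩ := hY.cover_adj v (mem_univ _) u (mem_univ _) huv
  refine ⟨j, ?_, hj⟩
  rintro rfl; exact hu hj'

/-- An interior vertex has all its neighbours among the other |Y| - 1 vertices of `Y`. -/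
theorem mem_boundary_of_card_le {G : FinGraph} [Fintype G.V] {Y : Finset G.V} {v : G.V}
    (hv : v ∈ Y) (h : #Y ≤ G.deg v) : v ∈ G.boundary Y := by
  classical
  by_contra hb
  rw [mem_boundary] at hb
  push Not at hb
  rw [deg_eq_card] at h
  have : univ.filter (G.graph.Adj v) ⊆ Y.erase v := by
    intro u hu
    rw [mem_filter] at hu
    rw [mem_erase]
    refine ⟨hu.2.ne', ?_⟩
    by_contra hu'
    exact hb hv u hu' hu.2
  have := card_le_card this
  rw [card_erase_of_mem hv] at this
  have := card_pos.2 ⟨v, hv⟩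
  omega

theorem IsDecomposition.deg_le {G : FinGraph} {k : ℕ} [Fintype G.V] [DecidableEq G.V] {ι : Type}
    [Fintype ι] {Y : ι → Finset G.V} (hY : G.IsDecomposition k univ Y) (v : G.V) :
    G.deg v ≤ ∑ i with v ∈ Y i, (#(Y i) - 1) := by
  classical
  rw [deg_eq_card]
  calc #(univ.filter (G.graph.Adj v))
      ≤ #((univ.filter (fun i => v ∈ Y i)).biUnion fun i => (Y i).erase v) := by
        apply card_le_card
        intro u hu
        rw [mem_filter] at hu
        obtain ⟨i, hi, hi'⟩ := hY.cover_adj v (mem_univ _) u (mem_univ _) hu.2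
        rw [mem_biUnion]
        exact ⟨i, by simpa using hi, mem_erase.2 ⟨hu.2.ne', hi'⟩⟩
    _ ≤ ∑ i with v ∈ Y i, #((Y i).erase v) := card_biUnion_le
    _ = _ := sum_congr rfl fun i hi => by
        rw [card_erase_of_mem (mem_filter.1 hi).2]

/-- The loss `k` in the excess is charged evenly to the boundary, so interior vertices keep full
weight 1. -/
theorem sum_boundary_weights {G : FinGraph} [DecidableEq G.V] (k : ℕ) {Y : Finset G.V}
    (h : (G.boundary Y).Nonempty) :
    ∑ v ∈ Y, (if v ∈ G.boundary Y then 1 - (k : ℚ) / #(G.boundary Y) else 1) = #Y - k := by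
  have ht : (#(G.boundary Y) : ℚ) ≠ 0 := by
    have := card_pos.2 h
    positivity
  have h1 : ∀ v ∈ Y, (if v ∈ G.boundary Y then 1 - (k : ℚ) / #(G.boundary Y) else 1) =
      1 - (if v ∈ G.boundary Y then (k : ℚ) / #(G.boundary Y) else 0) := by
    intro v _; split_ifs <;> simp
  rw [sum_congr rfl h1, sum_sub_distrib, ← sum_filter, filter_mem_eq_inter,
    inter_eq_right.2 (boundary_subset Y)]
  simp only [sum_const, nsmul_eq_mul, mul_one]
  field_simp

theorem boundary_nonempty {G : FinGraph} [Fintype G.V] {c : ℕ} {Y : Finset G.V}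
    (hY : Y.Nonempty) (h : (∃ v ∈ Y, v ∉ G.boundary Y) → c < #(G.boundary Y)) :
    (G.boundary Y).Nonempty := by
  obtain ⟨v, hv⟩ := hY
  by_cases hb : v ∈ G.boundary Y
  · exact ⟨v, hb⟩
  · exact card_pos.1 (by have := h ⟨v, hv, hb⟩; omega)

open Classical in
-- Small parts share weight 1 equally; in larger parts the boundary bears the loss. Every weight is
-- then at least 1/(k+1). A vertex is served by one large part, together with any second part if it
-- lies on the boundary, or else all its parts are of moderate size and its degree forces enough
-- weight.
theorem psiCBound_two_mul_sq_sub_one {k : ℕ} (hk : 0 < k) : PsiCBound k (2 * k ^ 2 - 1) := by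
  have hk2 : k ≤ k ^ 2 := by nlinarith
  refine PsiCBound.of_weights hk (by omega) ?_
  intro G _ _ hdeg ι _ Y hY hne hbd
  have hdeg' : ∀ v, 2 * k ^ 2 ≤ G.deg v := fun v => by have := hdeg v; omega
  let w : ι → G.V → ℚ := fun i v =>
    if #(Y i) ≤ k + 1 then 1 / (#(Y i) : ℚ)
    else if v ∈ G.boundary (Y i) then 1 - (k : ℚ) / #(G.boundary (Y i)) else 1
  have hYpos : ∀ i, 0 < #(Y i) := fun i => card_pos.2 (by simpa using hY.nonempty i)
  have hbne : ∀ i, ¬ #(Y i) ≤ k + 1 → (G.boundary (Y i)).Nonempty := fun i hi =>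
    boundary_nonempty (card_pos.1 (hYpos i)) (hbd i (by omega))
  have hkq : (1 : ℚ) ≤ k := by exact_mod_cast hk
  refine ⟨w, fun i => ?_, fun v => ?_⟩
  · by_cases hi : #(Y i) ≤ k + 1
    · simp only [w, hi, if_true, sum_const, nsmul_eq_mul]
      have : (#(Y i) : ℚ) ≠ 0 := by have := hYpos i; positivity
      rw [mul_one_div_cancel this]
      unfold excess; exact_mod_cast le_max_left _ _
    · simp only [w, hi, if_false]
      rw [sum_boundary_weights k (hbne i hi)]
      have h1 : #(Y i) - k ≤ excess k (Y i) := le_max_right _ _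
      have h2 : (#(Y i) : ℚ) - k = ((#(Y i) - k : ℕ) : ℚ) := by
        rw [Nat.cast_sub (by omega)]
      rw [h2]
      exact_mod_cast h1
  · have hbcard : ∀ i, ¬ #(Y i) ≤ k + 1 → k + 1 ≤ #(G.boundary (Y i)) := by
      intro i hi
      by_cases hint : ∃ v ∈ Y i, v ∉ G.boundary (Y i)
      · have h1 := hbd i (by omega) hint
        omega
      · push Not at hint
        have := card_le_card (show Y i ⊆ G.boundary (Y i) from hint)
        omega
    have hlow : ∀ i, 1 / ((k : ℚ) + 1) ≤ w i v := by
      intro i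
      by_cases hi : #(Y i) ≤ k + 1
      · simp only [w, hi, if_true]
        apply one_div_le_one_div_of_le
        · exact_mod_cast hYpos i
        · exact_mod_cast hi
      · simp only [w, hi, if_false]
        split_ifs with hv
        · have h1 : ((k : ℚ) + 1) ≤ #(G.boundary (Y i)) := by exact_mod_cast hbcard i hi
          rw [le_sub_iff_add_le, div_add_div _ _ (by positivity) (by positivity),
            div_le_one (by positivity)]
          nlinarith
        · rw [div_le_one (by positivity)]; linarith
    have hpos : ∀ i, 0 ≤ w i v := fun i => le_trans (by positivity) (hlow i)
    -- The threshold k² + k makes the boundary weight at least 1 - 1/(k+1), which any second part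
    -- completes to 1.
    by_cases hbig : ∃ i, v ∈ Y i ∧ ¬ #(Y i) ≤ k + 1 ∧
        (v ∈ G.boundary (Y i) → k ^ 2 + k ≤ #(G.boundary (Y i)))
    · obtain ⟨i, hvi, hi, hb⟩ := hbig
      by_cases hvb : v ∈ G.boundary (Y i)
      · obtain ⟨j, hji, hvj⟩ := hY.exists_other hvb
        have h1 : w i v + w j v ≤ ∑ i with v ∈ Y i, w i v := by
          rw [← sum_pair (f := fun i => w i v) hji.symm]
          apply sum_le_sum_of_subset_of_nonneg
          · intro x hx
            simp only [mem_insert, mem_singleton] at hx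
            rcases hx with rfl | rfl <;> simp [hvi, hvj]
          · exact fun x _ _ => hpos x
        have h2 : 1 - 1 / ((k : ℚ) + 1) ≤ w i v := by
          simp only [w, hi, if_false, hvb, if_true]
          apply sub_le_sub_left
          have h3 : (k : ℚ) ^ 2 + k ≤ #(G.boundary (Y i)) := by exact_mod_cast hb hvb
          rw [div_le_div_iff₀ (by nlinarith) (by positivity)]
          nlinarith
        have := hlow j
        linarith
      · have h1 : w i v ≤ ∑ i with v ∈ Y i, w i v :=
          single_le_sum (f := fun i => w i v) (fun x _ => hpos x) (by simp [hvi])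
        have h2 : w i v = 1 := by simp only [w, hi, if_false, hvb]
        linarith
    · push Not at hbig
      -- Each part pays in proportion to the number of neighbours it can supply to `v`, and `v` has
      -- at least 2k² neighbours.
      have hlin : ∀ i, v ∈ Y i → ((#(Y i) - 1 : ℕ) : ℚ) / (2 * (k : ℚ) ^ 2) ≤ w i v := by
        intro i hvi
        have hc1 : ((#(Y i) - 1 : ℕ) : ℚ) = (#(Y i) : ℚ) - 1 := by
          rw [Nat.cast_sub (hYpos i)]; simp
        have hcp : (0 : ℚ) < #(Y i) := by exact_mod_cast hYpos i
        rw [hc1]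
        by_cases hi : #(Y i) ≤ k + 1
        · simp only [w, hi, if_true]
          have : (#(Y i) : ℚ) ≤ k + 1 := by exact_mod_cast hi
          rw [div_le_div_iff₀ (by positivity) hcp]
          nlinarith
        · obtain ⟨hvb, hlt⟩ := hbig i hvi (by omega)
          have hall : G.boundary (Y i) = Y i := by
            apply Subset.antisymm (boundary_subset _)
            by_contra hint
            rw [not_subset] at hint
            have h1 := hbd i (by omega) hint
            have h2 : k ^ 2 + k ≤ 2 * k ^ 2 := by omega
            omega
          simp only [w, hi, if_false, hvb, if_true]
          rw [hall] at hlt ⊢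
          have h1 : (k : ℚ) + 2 ≤ #(Y i) := by
            have : k + 2 ≤ #(Y i) := by omega
            exact_mod_cast this
          have h2 : (#(Y i) : ℚ) + 1 ≤ k ^ 2 + k := by exact_mod_cast hlt
          rw [one_sub_div hcp.ne', div_le_div_iff₀ (by positivity) hcp]
          -- The inequality is quadratic in y = |Y| and concave, so it holds between k + 1 and 2k² -
          -- k; here y < k² + k, and k² + k - 1 ≤ 2k² - k because (k - 1)² ≥ 0.
          have h3 : (0 : ℚ) ≤ (#(Y i) - (k + 1)) * ((2 * k ^ 2 - k) - #(Y i)) := by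
            apply mul_nonneg
            · linarith
            · nlinarith [sq_nonneg ((k : ℚ) - 1)]
          nlinarith
      have h1 := hY.deg_le v
      have h2 : (2 * (k : ℚ) ^ 2) ≤ ∑ i with v ∈ Y i, ((#(Y i) - 1 : ℕ) : ℚ) := by
        have := (hdeg' v).trans h1
        exact_mod_cast this
      have h3 : ∑ i with v ∈ Y i, ((#(Y i) - 1 : ℕ) : ℚ) / (2 * (k : ℚ) ^ 2) ≤
          ∑ i with v ∈ Y i, w i v := sum_le_sum fun i hi => hlin i (mem_filter.1 hi).2
      rw [← sum_div] at h3
      refine le_trans ?_ h3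
      rw [le_div_iff₀ (by positivity), one_mul]
      exact h2

end FinGraph

/-! ### The sharp upper bound for k = 2 -/

namespace FinGraph

open Finset

open Classical in
-- A vertex short of weight lies in exactly two parts, each with at most five vertices, and one of
-- them with at most three. Minimum degree 6 then forces the other to have five. The uniform weight
-- 3/5 there would not complete 1/3 to 1, so the excess 3 is split as 1/2 on the pair `U` and 2/3 on
-- the other three vertices; on `U` the repeated edge rules the case out.
theorem psiCBound_two : PsiCBound 2 5 := by
  refine PsiCBound.of_weights (by norm_num) (by norm_num) ?_
  intro G _ _ hdeg ι _ Y hY hne hbd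
  have hdeg' : ∀ v, 6 ≤ G.deg v := fun v => by have := hdeg v; omega
  choose U hUY hUcard hU using fun i => (hY.shared i).resolve_left (hne i)
  have hYpos : ∀ i, 0 < #(Y i) := fun i => card_pos.2 (by simpa using hY.nonempty i)
  have hbne : ∀ i, ¬ #(Y i) ≤ 3 → (G.boundary (Y i)).Nonempty := fun i hi =>
    boundary_nonempty (card_pos.1 (hYpos i)) (hbd i (by omega))
  have hsmall : ∀ i, #(Y i) ≤ 5 → G.boundary (Y i) = Y i := by
    intro i hi
    apply Subset.antisymm (boundary_subset _)
    intro v hv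
    exact mem_boundary_of_card_le hv (by have := hdeg' v; omega)
  let w : ι → G.V → ℚ := fun i v =>
    if #(Y i) ≤ 3 then 1 / (#(Y i) : ℚ)
    else if #(Y i) = 5 then (if v ∈ U i then 1 / 2 else 2 / 3)
    else if v ∈ G.boundary (Y i) then 1 - (2 : ℕ) / #(G.boundary (Y i)) else 1
  refine ⟨w, fun i => ?_, fun v => ?_⟩
  · by_cases hi : #(Y i) ≤ 3
    · simp only [w, hi, if_true, sum_const, nsmul_eq_mul]
      have : (#(Y i) : ℚ) ≠ 0 := by have := hYpos i; positivity
      rw [mul_one_div_cancel this]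
      unfold excess; exact_mod_cast le_max_left _ _
    by_cases h5 : #(Y i) = 5
    · simp only [w, h5, show ¬ (5 ≤ 3) by norm_num, if_false, if_true]
      have h1 : ∀ v ∈ Y i, (if v ∈ U i then (1 / 2 : ℚ) else 2 / 3) =
          2 / 3 - (if v ∈ U i then 1 / 6 else 0) := by
        intro v _; split_ifs <;> norm_num
      rw [sum_congr rfl h1, sum_sub_distrib, ← sum_filter, filter_mem_eq_inter,
        inter_eq_right.2 (hUY i)]
      simp only [sum_const, nsmul_eq_mul, h5, hUcard]
      unfold excess
      rw [h5]
      norm_num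
    · simp only [w, hi, if_false, h5]
      rw [sum_boundary_weights 2 (hbne i hi)]
      have h1 : #(Y i) - 2 ≤ excess 2 (Y i) := le_max_right _ _
      have h2 : (#(Y i) : ℚ) - (2 : ℕ) = ((#(Y i) - 2 : ℕ) : ℚ) := by
        rw [Nat.cast_sub (by omega)]
      rw [h2]
      exact_mod_cast h1
  · have hlow3 : ∀ i, #(Y i) ≤ 3 → 1 / 3 ≤ w i v := by
      intro i hi
      simp only [w, hi, if_true]
      apply one_div_le_one_div_of_le
      · exact_mod_cast hYpos i
      · exact_mod_cast hi
    have hbig : ∀ i, 6 ≤ #(Y i) → 2 / 3 ≤ w i v ∧ (v ∉ G.boundary (Y i) → w i v = 1) := by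
      intro i hi
      simp only [w, show ¬ #(Y i) ≤ 3 by omega, show ¬ #(Y i) = 5 by omega, if_false]
      have ht : 6 ≤ #(G.boundary (Y i)) := by
        by_cases hint : ∃ v ∈ Y i, v ∉ G.boundary (Y i)
        · exact hbd i (by omega) hint
        · push Not at hint
          exact hi.trans (card_le_card (show Y i ⊆ G.boundary (Y i) from hint))
      have ht' : (6 : ℚ) ≤ #(G.boundary (Y i)) := by exact_mod_cast ht
      constructor
      · split_ifs
        · rw [le_sub_iff_add_le, ← le_sub_iff_add_le', div_le_iff₀ (by positivity)]
          push_cast; linarith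
        · norm_num
      · intro h; simp [h]
    have hfour : ∀ i, v ∈ Y i → #(Y i) = 4 → w i v = 1 / 2 := by
      intro i hvi hi
      simp only [w, hsmall i (by omega : #(Y i) ≤ 5), hi, hvi]
      norm_num
    have hfive : ∀ i, #(Y i) = 5 → w i v = if v ∈ U i then 1 / 2 else 2 / 3 := by
      intro i hi
      simp only [w, hi]
      norm_num
    have hhalf : ∀ i, v ∈ Y i → 4 ≤ #(Y i) → 1 / 2 ≤ w i v := by
      intro i hvi hi
      rcases (by omega : #(Y i) = 4 ∨ #(Y i) = 5 ∨ 6 ≤ #(Y i)) with h | h | h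
      · rw [hfour i hvi h]
      · rw [hfive i h]; split_ifs <;> norm_num
      · have := (hbig i h).1; linarith
    have hlow : ∀ i, v ∈ Y i → 1 / 3 ≤ w i v := by
      intro i hvi
      by_cases h : #(Y i) ≤ 3
      · exact hlow3 i h
      · have := hhalf i hvi (by omega); linarith
    set F : Finset ι := univ.filter (fun i => v ∈ Y i) with hF
    have hFm : ∀ i, i ∈ F ↔ v ∈ Y i := by simp [hF]
    by_contra hlt
    push Not at hlt
    have hsub : ∀ I : Finset ι, I ⊆ F → ∑ i ∈ I, w i v < 1 := fun I hI => lt_of_le_of_lt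
      (sum_le_sum_of_subset_of_nonneg hI fun i hi _ => by
        have := hlow i ((hFm i).1 hi); linarith) hlt
    have hbdry : ∀ i, v ∈ Y i → v ∈ G.boundary (Y i) := by
      intro i hvi
      by_cases h : #(Y i) ≤ 5
      · rw [hsmall i h]; exact hvi
      · by_contra hvb
        have h1 := (hbig i (by omega)).2 hvb
        have h2 := hsub {i} (by simpa [hFm] using hvi)
        rw [sum_singleton] at h2
        linarith
    have htwo : ∀ i j, v ∈ Y i → v ∈ Y j → i ≠ j → w i v + w j v < 1 := by
      intro i j hi hj hij
      have := hsub {i, j} (by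
        intro x hx; simp only [mem_insert, mem_singleton] at hx
        rcases hx with rfl | rfl <;> simp [hFm, hi, hj])
      rwa [sum_pair (f := fun i => w i v) hij] at this
    have hcard : #F ≤ 2 := by
      have h1 : (#F : ℚ) * (1 / 3) ≤ ∑ i ∈ F, w i v := by
        rw [← nsmul_eq_mul, ← sum_const]
        exact sum_le_sum fun i hi => hlow i ((hFm i).1 hi)
      have h2 : (#F : ℚ) < 3 := by linarith
      have h3 : #F < 3 := by exact_mod_cast h2
      omega
    have hwlt : ∀ i, v ∈ Y i → w i v < 2 / 3 := by
      intro i hi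
      obtain ⟨j, hji, hj⟩ := hY.exists_other (hbdry i hi)
      have h1 := htwo i j hi hj hji.symm
      have h2 := hlow j hj
      linarith
    have hle5 : ∀ i, v ∈ Y i → #(Y i) ≤ 5 := by
      intro i hi
      by_contra h
      have h1 := (hbig i (by omega)).1
      have h2 := hwlt i hi
      linarith
    obtain ⟨i, hi⟩ := hY.cover v (mem_univ v)
    obtain ⟨j, hji, hj⟩ := hY.exists_other (hbdry i hi)
    have hFeq : F = {i, j} := by
      symm
      apply eq_of_subset_of_card_le
      · intro x hx; simp only [mem_insert, mem_singleton] at hx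
        rcases hx with rfl | rfl <;> simp [hFm, hi, hj]
      · rw [card_pair hji.symm]; exact hcard
    -- The two parts supply at most 4 + 2 neighbours. The partner `u` of `v` in `U i`, if adjacent
    -- to `v`, also lies in the other part, so it is counted twice and the degree is at most 5.
    have key : ∀ i j, F = {i, j} → j ≠ i → v ∈ Y i → v ∈ Y j → #(Y j) ≤ 3 → False := by
      intro i j hFeq hji hi hj hj3
      have hdv := hY.deg_le v
      rw [← hF, hFeq, sum_pair hji.symm] at hdv
      have h6 := hdeg' v
      have hi5 := hle5 i hi
      have hi5' : #(Y i) = 5 := by omega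
      have hvU : v ∈ U i := by
        by_contra hvU
        have h1 := hwlt i hi
        rw [hfive i hi5', if_neg hvU] at h1
        exact lt_irrefl _ h1
      obtain ⟨u, hu, huv⟩ := exists_mem_ne (by rw [hUcard]; norm_num : 1 < #(U i)) v
      have huY : u ∈ Y i := hUY i hu
      have hnb : univ.filter (G.graph.Adj v) ⊆ ((Y i).erase v).erase u ∪ (Y j).erase v := by
        intro x hx
        rw [mem_filter] at hx
        have hxv : x ≠ v := hx.2.ne'
        rw [mem_union]
        by_cases hxu : x = u
        · subst hxu
          obtain ⟨l, hli, hlv, hlx⟩ := hU i v hvU x hu hx.2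
          have hlF : l ∈ F := (hFm l).2 hlv
          rw [hFeq, mem_insert, mem_singleton] at hlF
          rcases hlF with rfl | rfl
          · exact absurd rfl hli
          · exact Or.inr (mem_erase.2 ⟨hxv, hlx⟩)
        · obtain ⟨l, hlv, hlx⟩ := hY.cover_adj v (mem_univ _) x (mem_univ _) hx.2
          have hlF : l ∈ F := (hFm l).2 hlv
          rw [hFeq, mem_insert, mem_singleton] at hlF
          rcases hlF with rfl | rfl
          · exact Or.inl (mem_erase.2 ⟨hxu, mem_erase.2 ⟨hxv, hlx⟩⟩)
          · exact Or.inr (mem_erase.2 ⟨hxv, hlx⟩)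
      have h7 := (card_le_card hnb).trans (card_union_le _ _)
      rw [← deg_eq_card, card_erase_of_mem (mem_erase.2 ⟨huv, huY⟩), card_erase_of_mem hi,
        card_erase_of_mem hj] at h7
      omega
    by_cases hj3 : #(Y j) ≤ 3
    · exact key i j hFeq hji hi hj hj3
    by_cases hi3 : #(Y i) ≤ 3
    · exact key j i (by rw [hFeq, pair_comm]) hji.symm hj hi hi3
    have h1 := hhalf i hi (by omega)
    have h2 := hhalf j hj (by omega)
    have h3 := htwo i j hi hj hji.symm
    linarith

end FinGraph

/-! ### Assembling graphs from graphs of bounded order -/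

namespace FinGraph

/-- The class of graphs with at most `M` vertices. -/
def smallGraphs (M : ℕ) : Set FinGraph := {H | Nat.card H.V ≤ M}

theorem hereditary_smallGraphs (M : ℕ) : Hereditary (smallGraphs M) where
  iso G H hG := by
    rintro ⟨e⟩
    have : Nat.card H.V = Nat.card G.V := Nat.card_congr e.toEquiv.symm
    change Nat.card H.V ≤ M
    rw [this]; exact hG
  induce G S hS hG := by
    have := G.finite
    have h : Nat.card S ≤ Nat.card G.V := Finite.card_subtype_le _
    exact h.trans hG

theorem induce_mem_smallGraphs {G : FinGraph} {M : ℕ} {S : Set G.V} (hS : S.Nonempty) :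
    G.induce S hS ∈ smallGraphs M ↔ S.ncard ≤ M := Iff.rfl

/-- The set `S` induces a graph in the `k`-closure of the class of graphs with at most `M`
vertices. -/
def InClosure (k M : ℕ) (G : FinGraph) (S : Set G.V) : Prop :=
  ∃ h : S.Nonempty, KClosure k (smallGraphs M) (G.induce S h)

namespace InClosure

variable {k M : ℕ} {G : FinGraph}

theorem of_ncard_le {S : Set G.V} (h : S.Nonempty) (hS : S.ncard ≤ M) : G.InClosure k M S :=
  ⟨h, .basic _ ((induce_mem_smallGraphs h).2 hS)⟩

theorem union {S T : Set G.V} (hS : G.InClosure k M S) (hT : G.InClosure k M T)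
    (hk : (S ∩ T).ncard ≤ k)
    (hadj : ∀ u ∈ S, ∀ v ∈ T, G.graph.Adj u v → u ∈ T ∨ v ∈ S) :
    G.InClosure k M (S ∪ T) := by
  obtain ⟨hS₀, hS⟩ := hS
  obtain ⟨hT₀, hT⟩ := hT
  refine ⟨hS₀.inl, .glue _ _ _ hS hT ?_⟩
  let f₁ : (G.induce S hS₀).V ↪ (G.induce (S ∪ T) hS₀.inl).V :=
    ⟨fun x => ⟨x.1, Or.inl x.2⟩, fun a b h => Subtype.ext (congrArg (fun z => z.1) h)⟩
  let f₂ : (G.induce T hT₀).V ↪ (G.induce (S ∪ T) hS₀.inl).V :=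
    ⟨fun x => ⟨x.1, Or.inr x.2⟩, fun a b h => Subtype.ext (congrArg (fun z => z.1) h)⟩
  have h1 : ∀ x, x ∈ Set.range f₁ ↔ x.1 ∈ S := by
    intro x; constructor
    · rintro ⟨a, rfl⟩; exact a.2
    · intro h; exact ⟨⟨x.1, h⟩, rfl⟩
  have h2 : ∀ x, x ∈ Set.range f₂ ↔ x.1 ∈ T := by
    intro x; constructor
    · rintro ⟨a, rfl⟩; exact a.2
    · intro h; exact ⟨⟨x.1, h⟩, rfl⟩
  have a1 : ∀ x y, ((G.induce S hS₀).graph.map f₁).Adj x y ↔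
      x.1 ∈ S ∧ y.1 ∈ S ∧ G.graph.Adj x.1 y.1 := by
    intro x y; constructor
    · rintro ⟨-, a, b, hab, rfl, rfl⟩; exact ⟨a.2, b.2, hab⟩
    · rintro ⟨hx, hy, h⟩
      refine ⟨fun he => h.ne (congrArg (fun z => z.1) he), ⟨x.1, hx⟩, ⟨y.1, hy⟩, h, rfl, rfl⟩
  have a2 : ∀ x y, ((G.induce T hT₀).graph.map f₂).Adj x y ↔
      x.1 ∈ T ∧ y.1 ∈ T ∧ G.graph.Adj x.1 y.1 := by
    intro x y; constructor
    · rintro ⟨-, a, b, hab, rfl, rfl⟩; exact ⟨a.2, b.2, hab⟩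
    · rintro ⟨hx, hy, h⟩
      refine ⟨fun he => h.ne (congrArg (fun z => z.1) he), ⟨x.1, hx⟩, ⟨y.1, hy⟩, h, rfl, rfl⟩
  refine ⟨f₁, f₂, ?_, ?_, ?_, ?_⟩
  · ext ⟨x, hx₁, hx₂⟩ ⟨y, hy₁, hy₂⟩
    rw [h1] at hx₁ hy₁
    rw [h2] at hx₂ hy₂
    change ((G.induce S hS₀).graph.map f₁).Adj x y ↔ ((G.induce T hT₀).graph.map f₂).Adj x y
    rw [a1, a2]
    tauto
  · have := G.finite
    refine le_trans (Set.ncard_le_ncard_of_injOn (t := S ∩ T) (fun x => x.1) ?_ ?_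
      (Set.toFinite _)) hk
    · rintro x ⟨hx₁, hx₂⟩
      exact ⟨(h1 x).1 hx₁, (h2 x).1 hx₂⟩
    · intro x _ y _ h; exact Subtype.ext h
  · ext x
    simp only [Set.mem_union, h1, h2, Set.mem_univ, iff_true]
    exact x.2
  · ext x y
    change G.graph.Adj x.1 y.1 ↔ ((G.induce S hS₀).graph.map f₁).Adj x y ∨
      ((G.induce T hT₀).graph.map f₂).Adj x y
    rw [a1, a2]
    constructor
    · intro h
      have hx : x.1 ∈ S ∨ x.1 ∈ T := x.2
      have hy : y.1 ∈ S ∨ y.1 ∈ T := y.2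
      have e1 := fun a b => hadj x.1 a y.1 b h
      have e2 := fun a b => hadj y.1 a x.1 b h.symm
      tauto
    · tauto

/-- The vertex and its at most `k` neighbours in `S` form a small graph, which is glued on along
those neighbours. -/
theorem insert (hkM : k + 1 ≤ M) {S : Set G.V} (hS : G.InClosure k M S) {v : G.V} (hv : v ∉ S)
    (hd : {u | u ∈ S ∧ G.graph.Adj v u}.ncard ≤ k) : G.InClosure k M (insert v S) := by
  have := G.finite
  have h1 : G.InClosure k M (Insert.insert v {u | u ∈ S ∧ G.graph.Adj v u}) :=
    of_ncard_le ⟨v, Set.mem_insert _ _⟩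
      ((Set.ncard_insert_le _ _).trans (by omega))
  have h2 := hS.union h1 (by
    refine (Set.ncard_le_ncard ?_ (Set.toFinite _)).trans hd
    rintro x ⟨hx, rfl | hx'⟩
    · exact absurd hx hv
    · exact hx') (by
    rintro x hx y (rfl | hy) hxy
    · exact Or.inl (Or.inr ⟨hx, hxy.symm⟩)
    · exact Or.inr hy.1)
  convert h2 using 1
  ext x
  simp only [Set.mem_insert_iff, Set.mem_union]
  constructor
  · rintro (h | h) <;> simp [h]
  · rintro (h | h | h)
    · exact Or.inr h
    · exact Or.inl h
    · exact Or.inr h.1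

theorem union_of_degree_le (hkM : k + 1 ≤ M) {S : Set G.V} (hS : G.InClosure k M S)
    (E : Set G.V) (hES : ∀ v ∈ E, v ∉ S) (hE : ∀ u ∈ E, ∀ v ∈ E, ¬ G.graph.Adj u v)
    (hd : ∀ v ∈ E, {u | u ∈ S ∧ G.graph.Adj v u}.ncard ≤ k) : G.InClosure k M (S ∪ E) := by
  have := G.finite
  induction E, Set.toFinite E using Set.Finite.induction_on with
  | empty => simpa using hS
  | @insert a E ha _ ih =>
    have h1 := ih (fun v hv => hES v (Or.inr hv))
      (fun u hu v hv => hE u (Or.inr hu) v (Or.inr hv)) (fun v hv => hd v (Or.inr hv))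
    rw [Set.union_insert]
    refine h1.insert hkM ?_ ?_
    · rintro (h | h)
      · exact hES a (Or.inl rfl) h
      · exact ha h
    · convert hd a (Or.inl rfl) using 2
      ext u
      constructor
      · rintro ⟨h | h, h'⟩
        · exact ⟨h, h'⟩
        · exact absurd h' (hE a (Or.inl rfl) u (Or.inr h))
      · rintro ⟨h, h'⟩; exact ⟨Or.inl h, h'⟩

/-- When the sets are glued on one at a time, each meets the union built so far only inside `D`. -/
theorem iUnion {τ : Type} [Finite τ] [Nonempty τ] {S : τ → Set G.V} (D : Set G.V)
    (hS : ∀ t, G.InClosure k M (S t)) (hD : D.ncard ≤ k)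
    (hSD : ∀ t t', t ≠ t' → S t ∩ S t' ⊆ D)
    (hadj : ∀ t t', t ≠ t' → ∀ u ∈ S t, ∀ v ∈ S t', G.graph.Adj u v → u ∈ S t' ∨ v ∈ S t) :
    G.InClosure k M (⋃ t, S t) := by
  classical
  have := G.finite
  have := Fintype.ofFinite τ
  have key : ∀ F : Finset τ, F.Nonempty → G.InClosure k M (⋃ t ∈ F, S t) := by
    intro F hF
    induction hF using Finset.Nonempty.cons_induction with
    | singleton a => simpa using hS a
    | cons a F ha hF ih =>
      have h2 := ih.union (hS a) (by
        refine (Set.ncard_le_ncard ?_ (Set.toFinite _)).trans hD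
        rintro x ⟨hx, hx'⟩
        simp only [Set.mem_iUnion] at hx
        obtain ⟨t, ht, hx⟩ := hx
        exact hSD t a (by rintro rfl; exact ha ht) ⟨hx, hx'⟩) (by
        intro u hu v hv huv
        simp only [Set.mem_iUnion] at hu ⊢
        obtain ⟨t, ht, hu⟩ := hu
        rcases hadj t a (by rintro rfl; exact ha ht) u hu v hv huv with h | h
        · exact Or.inl h
        · exact Or.inr ⟨t, ht, h⟩)
      convert h2 using 1
      ext x
      simp only [Set.mem_iUnion, Finset.mem_cons, Set.mem_union]
      constructor
      · rintro ⟨t, rfl | ht, hx⟩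
        · exact Or.inr hx
        · exact Or.inl ⟨t, ht, hx⟩
      · rintro (⟨t, ht, hx⟩ | hx)
        · exact ⟨t, Or.inr ht, hx⟩
        · exact ⟨a, Or.inl rfl, hx⟩
  simpa using key Finset.univ Finset.univ_nonempty

theorem congr {S T : Set G.V} (h : G.InClosure k M S) (hST : ∀ v, v ∈ T ↔ v ∈ S) :
    G.InClosure k M T := by
  rwa [Set.ext hST]

theorem kClosure (h : G.InClosure k M Set.univ) : KClosure k (smallGraphs M) G := by
  obtain ⟨h, hG⟩ := h
  refine hG.of_iso (hereditary_smallGraphs M) ?_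
  exact
    { toFun := fun x => x.1
      invFun := fun x => ⟨x, trivial⟩
      left_inv := fun x => rfl
      right_inv := fun x => rfl
      map_rel_iff' := Iff.rfl }

end InClosure

end FinGraph

/-! ### Piece graphs: general lower bounds and construction rules -/

namespace FinGraph

section Blowup

variable {P ι : Type}

/-- The piece that contains a vertex of a piece graph, if any. -/
def pieceOf (own : P → Option ι) (q : ℕ) : P ⊕ ι × Fin q → Option ι
  | .inl p => own p
  | .inr (x, _) => some x

/-- Given a graph `Γ` on a set of ports, some of which are owned by pieces, add to each piece
a clique of `q` vertices that are joined to all the ports of the piece. -/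
def pieceGraph (Γ : SimpleGraph P) (own : P → Option ι) (q : ℕ) :
    SimpleGraph (P ⊕ ι × Fin q) where
  Adj v w := (∃ p p', v = .inl p ∧ w = .inl p' ∧ Γ.Adj p p') ∨
    (v ≠ w ∧ (v.isRight ∨ w.isRight) ∧ pieceOf own q v = pieceOf own q w)
  symm := ⟨by
    rintro v w (⟨p, p', rfl, rfl, h⟩ | ⟨h1, h2, h3⟩)
    · exact Or.inl ⟨p', p, rfl, rfl, h.symm⟩
    · exact Or.inr ⟨h1.symm, h2.symm, h3.symm⟩⟩
  loopless := ⟨by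
    rintro v (⟨p, p', rfl, h, h'⟩ | ⟨h, -⟩)
    · cases h; exact Γ.loopless.irrefl _ h'
    · exact h rfl⟩

variable {Γ : SimpleGraph P} {own : P → Option ι} {q : ℕ}

theorem pieceGraph_adj_inl {p p' : P} :
    (pieceGraph Γ own q).Adj (.inl p) (.inl p') ↔ Γ.Adj p p' := by
  simp [pieceGraph]

theorem pieceGraph_adj_of_pieceOf {v : P ⊕ ι × Fin q} {x : ι} {u : Fin q}
    (h : pieceOf own q v = some x) (hv : v ≠ .inr (x, u)) :
    (pieceGraph Γ own q).Adj v (.inr (x, u)) :=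
  Or.inr ⟨hv, Or.inr rfl, h⟩

/-- The piece graph as a `FinGraph`. -/
abbrev pieces (Γ : SimpleGraph P) (own : P → Option ι) (q : ℕ) [Finite P] [Finite ι] [Nonempty P] :
    FinGraph where
  V := P ⊕ ι × Fin q
  finite := inferInstance
  nonempty := inferInstance
  graph := pieceGraph Γ own q

variable [Finite P] [Finite ι]

/-- The clique of the piece `x`. -/
def hub (P : Type) (q : ℕ) (x : ι) : Set (P ⊕ ι × Fin q) := Set.range fun u => .inr (x, u)

omit [Finite P] [Finite ι] in
theorem ncard_hub (x : ι) : (hub P q x).ncard = q := by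
  rw [hub, ← Set.image_univ, Set.ncard_image_of_injective, Set.ncard_univ, Nat.card_fin]
  intro a b h; simpa using h

/-- With fewer than `c` outer neighbours, `A` contains almost all of the hub of every piece it
meets, and it is too small to do so for two pieces. So it meets at most one piece: a free port in
`A` then sees `c` ports outside `A`, and without free ports the matching leaving the piece provides
`c` outer neighbours. -/
theorem le_ncard_outer_boundary [Nonempty ι] {m c : ℕ} (hq : m + 2 * c ≤ q)
    (hout : ∀ x, ∃ g f : Fin c → P, g.Injective ∧ f.Injective ∧ ∀ i, own (g i) = some x ∧
      own (f i) ≠ some x ∧ Γ.Adj (g i) (f i))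
    (hfree : ∀ p, own p = none → ∀ x,
      c ≤ {p' | Γ.Adj p p' ∧ own p' ≠ none ∧ own p' ≠ some x}.ncard)
    {A : Set (P ⊕ ι × Fin q)} (hA : A.Nonempty) (hcard : A.ncard ≤ m + q) :
    c ≤ {v | v ∉ A ∧ ∃ a ∈ A, (pieceGraph Γ own q).Adj a v}.ncard := by
  by_contra hlt
  push Not at hlt
  set N := {v | v ∉ A ∧ ∃ a ∈ A, (pieceGraph Γ own q).Adj a v} with hN
  have hmeet : ∀ x, (∃ a ∈ A, pieceOf own q a = some x) → q + 1 ≤ (A ∩ hub P q x).ncard + c := by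
    rintro x ⟨a, ha, hax⟩
    have h1 : hub P q x \ A ⊆ N := by
      rintro _ ⟨⟨u, rfl⟩, hu⟩
      exact ⟨hu, a, ha, pieceGraph_adj_of_pieceOf hax (by rintro rfl; exact hu ha)⟩
    have h2 := Set.ncard_le_ncard h1 (Set.toFinite _)
    have h3 := Set.ncard_inter_add_ncard_sdiff_eq_ncard (hub P q x) A (Set.toFinite _)
    rw [ncard_hub, Set.inter_comm] at h3
    omega
  have hunique : ∀ x y, (∃ a ∈ A, pieceOf own q a = some x) →
      (∃ a ∈ A, pieceOf own q a = some y) → x = y := by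
    intro x y hx hy
    by_contra hxy
    have h1 := hmeet x hx
    have h2 := hmeet y hy
    have hdisj : Disjoint (A ∩ hub P q x) (A ∩ hub P q y) := by
      rw [Set.disjoint_left]
      rintro _ ⟨-, ⟨u, rfl⟩⟩ ⟨-, ⟨u', h⟩⟩
      simp only [Sum.inr.injEq, Prod.mk.injEq] at h
      exact hxy h.1.symm
    have h3 := Set.ncard_union_eq hdisj (Set.toFinite _) (Set.toFinite _)
    have h4 : (A ∩ hub P q x ∪ A ∩ hub P q y).ncard ≤ A.ncard :=
      Set.ncard_le_ncard (by rintro z (h | h) <;> exact h.1) (Set.toFinite _)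
    omega
  have hx₀ : ∃ x₀, ∀ a ∈ A, pieceOf own q a = none ∨ pieceOf own q a = some x₀ := by
    by_cases h : ∃ x, ∃ a ∈ A, pieceOf own q a = some x
    · obtain ⟨x, hx⟩ := h
      refine ⟨x, fun a ha => ?_⟩
      cases hax : pieceOf own q a with
      | none => exact Or.inl rfl
      | some y => exact Or.inr (by rw [hunique y x ⟨a, ha, hax⟩ hx])
    · push Not at h
      refine ⟨Classical.arbitrary ι, fun a ha => Or.inl ?_⟩
      cases hax : pieceOf own q a with
      | none => rfl
      | some y => exact absurd hax (h y a ha)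
  obtain ⟨x₀, hx₀⟩ := hx₀
  by_cases hd : ∃ a ∈ A, pieceOf own q a = none
  · obtain ⟨a, ha, hax⟩ := hd
    rcases a with p | ⟨x, u⟩
    · have h1 := hfree p hax x₀
      have h2 : Sum.inl '' {p' | Γ.Adj p p' ∧ own p' ≠ none ∧ own p' ≠ some x₀} ⊆ N := by
        rintro _ ⟨p', ⟨h, h', h''⟩, rfl⟩
        refine ⟨fun hA' => ?_, _, ha, pieceGraph_adj_inl.2 h⟩
        rcases hx₀ _ hA' with e | e
        · exact h' e
        · exact h'' e
      have h3 := Set.ncard_le_ncard h2 (Set.toFinite _)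
      rw [Set.ncard_image_of_injective _ Sum.inl_injective] at h3
      omega
    · simp [pieceOf] at hax
  · push Not at hd
    have hall : ∀ a ∈ A, pieceOf own q a = some x₀ := fun a ha =>
      (hx₀ a ha).resolve_left (hd a ha)
    obtain ⟨a, ha⟩ := hA
    have h1 := hmeet x₀ ⟨a, ha, hall a ha⟩
    have h2 : (A ∩ hub P q x₀).Nonempty := by
      rw [← Set.ncard_pos]; omega
    obtain ⟨_, hb, ⟨u, rfl⟩⟩ := h2
    obtain ⟨g, f, hg, hf, hgf⟩ := hout x₀
    classical
    -- Each matching edge contributes one outer neighbour: its far end if the near end is in `A`,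
    -- and otherwise the near end, which is adjacent to a hub vertex in `A`.
    let h : Fin c → P ⊕ ι × Fin q := fun i => if .inl (g i) ∈ A then .inl (f i) else .inl (g i)
    have hinj : Function.Injective h := by
      intro i j hij
      simp only [h] at hij
      split_ifs at hij with h1 h2 h2
      · exact hf (Sum.inl_injective hij)
      · have := Sum.inl_injective hij
        exact absurd ((hgf j).1) (this ▸ (hgf i).2.1)
      · have := Sum.inl_injective hij
        exact absurd ((hgf i).1) (this ▸ (hgf j).2.1)
      · exact hg (Sum.inl_injective hij)
    have hsub : Set.range h ⊆ N := by
      rintro _ ⟨i, rfl⟩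
      simp only [h]
      split_ifs with hi
      · exact ⟨fun hA' => (hgf i).2.1 (hall _ hA'), _, hi, pieceGraph_adj_inl.2 (hgf i).2.2⟩
      · exact ⟨hi, _, hb, (pieceGraph_adj_of_pieceOf (v := .inl (g i)) (hgf i).1 (by simp)).symm⟩
    have h3 := Set.ncard_le_ncard hsub (Set.toFinite _)
    rw [← Set.image_univ, Set.ncard_image_of_injective _ hinj, Set.ncard_univ, Nat.card_fin] at h3
    omega

theorem le_of_phiBound_of_pieces [Nonempty P] [Nonempty ι] {k m c : ℕ} (hc : 0 < c)
    (hq : m + 2 * c ≤ q)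
    (hout : ∀ x, ∃ g f : Fin c → P, g.Injective ∧ f.Injective ∧ ∀ i, own (g i) = some x ∧
      own (f i) ≠ some x ∧ Γ.Adj (g i) (f i))
    (hfree : ∀ p, own p = none → ∀ x,
      c ≤ {p' | Γ.Adj p p' ∧ own p' ≠ none ∧ own p' ≠ some x}.ncard)
    (hG : (pieces Γ own q).InClosure k (m + q) Set.univ) {c' : ℕ} (h : PhiBound k c') :
    c ≤ c' := by
  rcases h _ (hereditary_smallGraphs _) _ hG.kClosure with hm | ⟨A, B, C, hp, hA, hC⟩
  · have h1 := le_ncard_outer_boundary hq hout hfree (A := Set.univ) Set.univ_nonempty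
      (by rw [Set.ncard_univ]; exact hm)
    simp at h1
    omega
  · have h1 := le_ncard_outer_boundary hq hout hfree hp.nonempty_left hA
    refine (h1.trans (Set.ncard_le_ncard ?_ (Set.toFinite _))).trans hC
    rintro v ⟨hv, a, ha, hav⟩
    have : v ∈ A ∪ B ∪ C := by rw [hp.union_eq]; trivial
    rcases this with (h | h) | h
    · exact absurd h hv
    · exact absurd hav (hp.anticomplete a ha v h)
    · exact h

/-- Here `C` cannot contain a whole hub, so if `A` meets a piece, then `A ∪ C` contains that piece
and equals it by cardinality. Every port of the piece has a neighbour elsewhere, hence lies in `C`.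
If `A` meets no piece, the owned neighbours of a free port of `A` lie in `C`. -/
theorem le_ncard_of_absorbing {m : ℕ} (hq : m ≤ q)
    (hm : ∀ x, {p | own p = some x}.ncard = m)
    (hout : ∀ p x, own p = some x → ∃ p', own p' ≠ some x ∧ Γ.Adj p p')
    (hfree : ∀ p, own p = none → m ≤ {p' | Γ.Adj p p' ∧ own p' ≠ none}.ncard)
    {A C : Set (P ⊕ ι × Fin q)} (hA : A.Nonempty)
    (hN : ∀ a ∈ A, ∀ v, (pieceGraph Γ own q).Adj a v → v ∈ A ∪ C)
    (hAC : (A ∪ C).ncard ≤ m + q) : m ≤ C.ncard := by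
  by_contra hlt
  push Not at hlt
  by_cases hmeet : ∃ a ∈ A, ∃ x, pieceOf own q a = some x
  · obtain ⟨a, ha, x, hax⟩ := hmeet
    have h1 : hub P q x ⊆ A ∪ C := by
      rintro _ ⟨u, rfl⟩
      by_cases hau : a = .inr (x, u)
      · left; rw [hau] at ha; exact ha
      · exact hN a ha _ (pieceGraph_adj_of_pieceOf hax hau)
    have h2 : ∃ u, (Sum.inr (x, u) : P ⊕ ι × Fin q) ∈ A := by
      by_contra hno
      push Not at hno
      have h3 : hub P q x ⊆ C := by
        rintro _ ⟨u, rfl⟩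
        exact (h1 ⟨u, rfl⟩).resolve_left (hno u)
      have h4 := Set.ncard_le_ncard h3 (Set.toFinite _)
      rw [ncard_hub] at h4
      omega
    obtain ⟨u, hu⟩ := h2
    have h3 : Sum.inl '' {p | own p = some x} ∪ hub P q x ⊆ A ∪ C := by
      rintro _ (⟨p, hpx, rfl⟩ | h)
      · exact hN _ hu _ (pieceGraph_adj_of_pieceOf (v := .inl p) hpx (by simp)).symm
      · exact h1 h
    have h4 : (Sum.inl '' {p | own p = some x} ∪ hub P q x).ncard = m + q := by
      rw [Set.ncard_union_eq _ (Set.toFinite _) (Set.toFinite _), ncard_hub,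
        Set.ncard_image_of_injective _ Sum.inl_injective, hm]
      rw [Set.disjoint_left]
      rintro _ ⟨p, -, rfl⟩ ⟨u, h⟩
      simp at h
    have h5 := Set.eq_of_subset_of_ncard_le h3 (by rw [h4]; exact hAC) (Set.toFinite _)
    have h6 : Sum.inl '' {p | own p = some x} ⊆ C := by
      rintro _ ⟨p, hpx, rfl⟩
      have h7 := h3 (Or.inl ⟨p, hpx, rfl⟩)
      refine h7.resolve_left fun hpA => ?_
      obtain ⟨p', hp', hadj⟩ := hout p x hpx
      have h8 := hN _ hpA _ (pieceGraph_adj_inl.2 hadj)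
      rw [← h5] at h8
      rcases h8 with ⟨p'', h, h'⟩ | ⟨u, h⟩
      · cases Sum.inl_injective h'; exact hp' h
      · simp at h
    have h7 := Set.ncard_le_ncard h6 (Set.toFinite _)
    rw [Set.ncard_image_of_injective _ Sum.inl_injective, hm] at h7
    omega
  · push Not at hmeet
    obtain ⟨a, ha⟩ := hA
    rcases a with p | ⟨x, u⟩
    · have hown : own p = none := by
        cases hx : own p with
        | none => rfl
        | some x => exact absurd hx (hmeet _ ha x)
      have h1 : Sum.inl '' {p' | Γ.Adj p p' ∧ own p' ≠ none} ⊆ C := by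
        rintro _ ⟨p', ⟨h, h'⟩, rfl⟩
        refine (hN _ ha _ (pieceGraph_adj_inl.2 h)).resolve_left fun hA' => ?_
        cases hx : own p' with
        | none => exact h' hx
        | some x => exact hmeet _ hA' x hx
      have h2 := Set.ncard_le_ncard h1 (Set.toFinite _)
      rw [Set.ncard_image_of_injective _ Sum.inl_injective] at h2
      have := hfree p hown
      omega
    · exact hmeet _ ha x rfl

theorem le_ncard_neighborSet {m : ℕ} (hq : m + 1 ≤ q)
    (hfree : ∀ p, own p = none → m ≤ {p' | Γ.Adj p p' ∧ own p' ≠ none}.ncard)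
    (v : P ⊕ ι × Fin q) : m ≤ ((pieceGraph Γ own q).neighborSet v).ncard := by
  by_cases hx : ∃ x, pieceOf own q v = some x
  · obtain ⟨x, hx⟩ := hx
    have h1 : hub P q x \ {v} ⊆ (pieceGraph Γ own q).neighborSet v := by
      rintro _ ⟨⟨u, rfl⟩, hu⟩
      exact pieceGraph_adj_of_pieceOf hx (Ne.symm hu)
    have h2 := Set.ncard_le_ncard h1 (Set.toFinite _)
    have h3 := Set.ncard_le_ncard_sdiff_add_ncard (hub P q x) {v} (Set.toFinite _)
    rw [ncard_hub, Set.ncard_singleton] at h3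
    omega
  · push Not at hx
    rcases v with p | ⟨x, u⟩
    · have hown : own p = none := by
        cases h : own p with
        | none => rfl
        | some x => exact absurd h (hx x)
      have h1 : Sum.inl '' {p' | Γ.Adj p p' ∧ own p' ≠ none} ⊆
          (pieceGraph Γ own q).neighborSet (.inl p) := by
        rintro _ ⟨p', h, rfl⟩
        exact pieceGraph_adj_inl.2 h.1
      have h2 := Set.ncard_le_ncard h1 (Set.toFinite _)
      rw [Set.ncard_image_of_injective _ Sum.inl_injective] at h2
      have := hfree p hown
      omega
    · exact absurd rfl (hx x)

theorem le_of_psiBound_of_pieces [Nonempty P] [Nonempty ι] {k m : ℕ} (hm₀ : 0 < m)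
    (hq : m + 1 ≤ q) (hm : ∀ x, {p | own p = some x}.ncard = m)
    (hout : ∀ p x, own p = some x → ∃ p', own p' ≠ some x ∧ Γ.Adj p p')
    (hfree : ∀ p, own p = none → m ≤ {p' | Γ.Adj p p' ∧ own p' ≠ none}.ncard)
    (hG : (pieces Γ own q).InClosure k (m + q) Set.univ) {c : ℕ}
    (h : PsiBound k c) : m ≤ c := by
  rcases h _ (hereditary_smallGraphs _) _ hG.kClosure with hs | ⟨A, B, C, hp, hAC, hC⟩ | ⟨v, hv⟩
  · have h1 := le_ncard_of_absorbing (A := Set.univ) (C := ∅) (show m ≤ q by omega) hm hout hfree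
      Set.univ_nonempty (fun a _ v _ => Or.inl trivial)
      (by rw [Set.union_empty, Set.ncard_univ]; exact hs)
    rw [Set.ncard_empty] at h1
    omega
  · refine (le_ncard_of_absorbing (show m ≤ q by omega) hm hout hfree hp.nonempty_left ?_ hAC).trans hC
    intro a ha v hav
    have : v ∈ A ∪ B ∪ C := by rw [hp.union_eq]; trivial
    rcases this with (h | h) | h
    · exact Or.inl h
    · exact absurd hav (hp.anticomplete a ha v h)
    · exact Or.inr h
  · exact (le_ncard_neighborSet hq hfree v).trans hv

omit [Finite ι] in
/-- A port with neighbours in more than `c` pieces has `c` neighbours outside any given piece. -/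
theorem le_ncard_neighbors_off_piece {γ : Type} [Finite γ] {c : ℕ} (hc : c + 1 ≤ Nat.card γ)
    {p : P} (g : γ → P) (piece : γ → ι) (hpiece : piece.Injective)
    (hg : ∀ z, own (g z) = some (piece z) ∧ Γ.Adj p (g z)) (x : ι) :
    c ≤ {p' | Γ.Adj p p' ∧ own p' ≠ none ∧ own p' ≠ some x}.ncard := by
  have hinj : g.Injective := by
    intro a b hab
    have h1 := (hg a).1
    rw [hab, (hg b).1] at h1
    exact hpiece (Option.some_injective _ h1).symm
  have h1 : g '' {z | piece z ≠ x} ⊆ {p' | Γ.Adj p p' ∧ own p' ≠ none ∧ own p' ≠ some x} := by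
    rintro _ ⟨z, hz, rfl⟩
    refine ⟨(hg z).2, by rw [(hg z).1]; simp, ?_⟩
    rw [(hg z).1]
    exact fun h => hz (Option.some_injective _ h)
  have h2 := Set.ncard_le_ncard h1 (Set.toFinite _)
  rw [Set.ncard_image_of_injective _ hinj] at h2
  have h3 : {z | piece z = x}.ncard ≤ 1 := by
    rw [Set.ncard_le_one (Set.toFinite _)]
    intro a ha b hb
    exact hpiece (Eq.trans ha (Eq.symm hb))
  have h4 := Set.ncard_add_ncard_compl {z | piece z = x}
  have h5 : {z | piece z = x}ᶜ = {z | piece z ≠ x} := rfl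
  rw [h5] at h4
  omega

/-- The port `p` belongs to a piece of `T` or to `E`. -/
def PortIn (own : P → Option ι) (T : Set ι) (E : Set P) (p : P) : Prop :=
  p ∈ E ∨ ∃ x ∈ T, own p = some x

/-- The set of all vertices of the pieces in `T` together with the ports in `E`. -/
def region (own : P → Option ι) (q : ℕ) (T : Set ι) (E : Set P) : Set (P ⊕ ι × Fin q) :=
  {v | (∃ x ∈ T, pieceOf own q v = some x) ∨ ∃ p ∈ E, v = .inl p}

omit [Finite P] [Finite ι] in
theorem inl_mem_region {T : Set ι} {E : Set P} {p : P} :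
    .inl p ∈ region own q T E ↔ PortIn own T E p := by
  simp [region, PortIn, pieceOf, or_comm]

omit [Finite P] [Finite ι] in
theorem inr_mem_region {T : Set ι} {E : Set P} {x : ι} {u : Fin q} :
    .inr (x, u) ∈ region own q T E ↔ x ∈ T := by
  simp [region, pieceOf]

variable [Nonempty P] {k m : ℕ}

/-- The pieces in `T` together with the ports in `E` induce a graph in the closure. -/
def Buildable (k m : ℕ) (Γ : SimpleGraph P) (own : P → Option ι) (q : ℕ) (T : Set ι)
    (E : Set P) : Prop :=
  (pieces Γ own q).InClosure k (m + q) (region own q T E)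

namespace Buildable

theorem single (hq : 0 < q) (x : ι) (hm : {p | own p = some x}.ncard ≤ m) :
    Buildable k m Γ own q {x} ∅ := by
  refine InClosure.of_ncard_le ⟨.inr (x, ⟨0, hq⟩), inr_mem_region.2 rfl⟩ ?_
  have h1 : region own q {x} ∅ = Sum.inl '' {p | own p = some x} ∪ hub P q x := by
    ext v
    rcases v with p | ⟨y, u⟩
    · simp [inl_mem_region, PortIn, hub]
    · simp [inr_mem_region, hub, eq_comm]
  rw [h1]
  refine (Set.ncard_union_le _ (hub P q x)).trans ?_
  rw [ncard_hub]
  exact Nat.add_le_add_right ((Set.ncard_image_le (Set.toFinite _)).trans hm) _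

/-- The new ports need not be free: a port of a piece outside `T` may be added in advance, since its
hub is absent and only its `Γ`-neighbours count. -/
theorem addPorts (hkM : k + 1 ≤ m + q) {T : Set ι} {E : Set P}
    (h : Buildable k m Γ own q T E) (E' : Set P) (hE' : ∀ p ∈ E', ¬ PortIn own T E p)
    (hind : ∀ p ∈ E', ∀ p' ∈ E', ¬ Γ.Adj p p')
    (hd : ∀ p ∈ E', {p' | PortIn own T E p' ∧ Γ.Adj p p'}.ncard ≤ k) :
    Buildable k m Γ own q T (E ∪ E') := by
  have h1 := InClosure.union_of_degree_le hkM h (Sum.inl '' E') (by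
    rintro _ ⟨p, hp, rfl⟩ h'
    exact hE' p hp (inl_mem_region.1 h')) (by
    rintro _ ⟨p, hp, rfl⟩ _ ⟨p', hp', rfl⟩ h'
    exact hind p hp p' hp' (pieceGraph_adj_inl.1 h')) (by
    rintro _ ⟨p, hp, rfl⟩
    refine le_trans ?_ (hd p hp)
    refine (Set.ncard_le_ncard ?_ (Set.toFinite _)).trans
      (Set.ncard_image_le (f := Sum.inl) (Set.toFinite _))
    rintro (p' | ⟨x, u⟩) ⟨h1, h2⟩
    · exact ⟨p', ⟨inl_mem_region.1 h1, pieceGraph_adj_inl.1 h2⟩, rfl⟩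
    · exfalso
      rcases h2 with ⟨_, _, _, h2, _⟩ | ⟨-, -, h2⟩
      · cases h2
      · exact hE' p hp (Or.inr ⟨x, inr_mem_region.1 h1, h2⟩))
  refine h1.congr ?_
  rintro (p | ⟨x, u⟩)
  · change _ ↔ Sum.inl p ∈ region own q T E ∨ _
    rw [inl_mem_region, inl_mem_region]
    simp only [PortIn, Set.mem_union, Set.mem_image, Sum.inl.injEq, exists_eq_right]
    exact or_right_comm
  · change _ ↔ Sum.inr (x, u) ∈ region own q T E ∨ _
    rw [inr_mem_region, inr_mem_region]
    simp

omit [Finite P] [Finite ι] [Nonempty P] in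
-- An edge at a hub vertex stays inside its piece, so only edges between ports have to be checked.
theorem adj_mem_region {T T' : Set ι} {E E' : Set P}
    (hadj : ∀ p p', PortIn own T E p → PortIn own T' E' p' → Γ.Adj p p' →
      PortIn own T' E' p ∨ PortIn own T E p') {u v : P ⊕ ι × Fin q}
    (hu : u ∈ region own q T E) (hv : v ∈ region own q T' E')
    (huv : (pieceGraph Γ own q).Adj u v) :
    u ∈ region own q T' E' ∨ v ∈ region own q T E := by
  rcases huv with ⟨p, p', rfl, rfl, h⟩ | ⟨-, h, h'⟩
  · simp only [inl_mem_region] at hu hv ⊢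
    exact hadj p p' hu hv h
  · rcases h with h | h
    · rcases u with p | ⟨x, i⟩
      · cases h
      · exact Or.inr (Or.inl ⟨x, inr_mem_region.1 hu, h'.symm⟩)
    · rcases v with p | ⟨x, i⟩
      · cases h
      · exact Or.inl (Or.inl ⟨x, inr_mem_region.1 hv, h'⟩)

omit [Finite P] [Finite ι] [Nonempty P] in
theorem inter_region_subset {T T' : Set ι} (hT : Disjoint T T') {E E' : Set P} :
    region own q T E ∩ region own q T' E' ⊆ Sum.inl '' (E ∪ E') := by
  rintro (p | ⟨x, u⟩) ⟨h1, h2⟩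
  · rw [inl_mem_region] at h1 h2
    rcases h1 with h1 | ⟨x, hx, h1⟩
    · exact ⟨p, Or.inl h1, rfl⟩
    rcases h2 with h2 | ⟨y, hy, h2⟩
    · exact ⟨p, Or.inr h2, rfl⟩
    rw [h1] at h2
    cases h2
    exact absurd hy (Set.disjoint_left.1 hT hx)
  · rw [inr_mem_region] at h1 h2
    exact absurd h2 (Set.disjoint_left.1 hT h1)

/-- Disjoint families of pieces overlap only in ports added separately, so the gluing uses at most
|E ∪ E'| vertices. -/
theorem glue {T T' : Set ι} {E E' : Set P} (h : Buildable k m Γ own q T E)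
    (h' : Buildable k m Γ own q T' E') (hT : Disjoint T T') (hE : (E ∪ E').ncard ≤ k)
    (hadj : ∀ p p', PortIn own T E p → PortIn own T' E' p' → Γ.Adj p p' →
      PortIn own T' E' p ∨ PortIn own T E p') :
    Buildable k m Γ own q (T ∪ T') (E ∪ E') := by
  have h1 := InClosure.union h h' (by
    refine (Set.ncard_le_ncard (inter_region_subset hT) (Set.toFinite _)).trans ?_
    exact (Set.ncard_image_le (Set.toFinite _)).trans hE)
    (fun u hu v hv huv => adj_mem_region hadj hu hv huv)
  refine h1.congr ?_
  rintro (p | ⟨x, u⟩)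
  · change _ ↔ Sum.inl p ∈ region own q T E ∨ Sum.inl p ∈ region own q T' E'
    rw [inl_mem_region, inl_mem_region, inl_mem_region]
    simp only [PortIn, Set.mem_union]
    constructor
    · rintro ((h | h) | ⟨x, h | h, hx⟩)
      · exact Or.inl (Or.inl h)
      · exact Or.inr (Or.inl h)
      · exact Or.inl (Or.inr ⟨x, h, hx⟩)
      · exact Or.inr (Or.inr ⟨x, h, hx⟩)
    · rintro ((h | ⟨x, h, hx⟩) | (h | ⟨x, h, hx⟩))
      · exact Or.inl (Or.inl h)
      · exact Or.inr ⟨x, Or.inl h, hx⟩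
      · exact Or.inl (Or.inr h)
      · exact Or.inr ⟨x, Or.inr h, hx⟩
  · change _ ↔ Sum.inr (x, u) ∈ region own q T E ∨ Sum.inr (x, u) ∈ region own q T' E'
    rw [inr_mem_region, inr_mem_region, inr_mem_region]
    rfl

theorem congr {T T' : Set ι} {E E' : Set P} (h : Buildable k m Γ own q T E) (hT : T' = T)
    (hE : ∀ p, PortIn own T' E' p ↔ PortIn own T E p) : Buildable k m Γ own q T' E' := by
  subst hT
  refine InClosure.congr h ?_
  rintro (p | ⟨x, u⟩)
  · rw [inl_mem_region, inl_mem_region]; exact hE p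
  · rw [inr_mem_region, inr_mem_region]

theorem iUnion {τ : Type} [Finite τ] [Nonempty τ] {T : τ → Set ι} {E : τ → Set P} {D : Set P}
    (h : ∀ t, Buildable k m Γ own q (T t) (E t ∪ D))
    (hT : ∀ t t', t ≠ t' → Disjoint (T t) (T t')) (hD : D.ncard ≤ k)
    (hE : ∀ t t', t ≠ t' → ∀ p, PortIn own (T t) (E t) p → ¬ PortIn own (T t') (E t') p)
    (hadj : ∀ t t', t ≠ t' → ∀ p p', PortIn own (T t) (E t) p →
      PortIn own (T t') (E t') p' → ¬ Γ.Adj p p') :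
    Buildable k m Γ own q (⋃ t, T t) ((⋃ t, E t) ∪ D) := by
  have hsplit : ∀ t p, PortIn own (T t) (E t ∪ D) p → p ∈ D ∨ PortIn own (T t) (E t) p := by
    rintro t p ((h | h) | h)
    · exact Or.inr (Or.inl h)
    · exact Or.inl h
    · exact Or.inr (Or.inr h)
  have h1 := InClosure.iUnion (Sum.inl '' D) h ((Set.ncard_image_le (Set.toFinite _)).trans hD)
    (fun t t' htt' => by
      rintro (p | ⟨x, u⟩) ⟨h1, h2⟩
      · rw [inl_mem_region] at h1 h2
        rcases hsplit t p h1 with h1 | h1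
        · exact ⟨p, h1, rfl⟩
        rcases hsplit t' p h2 with h2 | h2
        · exact ⟨p, h2, rfl⟩
        exact absurd h2 (hE t t' htt' p h1)
      · rw [inr_mem_region] at h1 h2
        exact absurd h2 (Set.disjoint_left.1 (hT t t' htt') h1))
    (fun t t' htt' u hu v hv huv => adj_mem_region (fun p p' hp hp' hpp' => by
      rcases hsplit t p hp with hp | hp
      · exact Or.inl (Or.inl (Or.inr hp))
      rcases hsplit t' p' hp' with hp' | hp'
      · exact Or.inr (Or.inl (Or.inr hp'))
      exact absurd hpp' (hadj t t' htt' p p' hp hp')) hu hv huv)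
  refine h1.congr fun v => ?_
  simp only [Set.mem_iUnion]
  rcases v with p | ⟨x, u⟩
  · simp only [inl_mem_region, PortIn, Set.mem_iUnion, Set.mem_union]
    constructor
    · rintro ((⟨t, h⟩ | h) | ⟨x, ⟨t, ht⟩, hx⟩)
      · exact ⟨t, Or.inl (Or.inl h)⟩
      · exact ⟨Classical.arbitrary τ, Or.inl (Or.inr h)⟩
      · exact ⟨t, Or.inr ⟨x, ht, hx⟩⟩
    · rintro ⟨t, (h | h) | ⟨x, ht, hx⟩⟩
      · exact Or.inl (Or.inl ⟨t, h⟩)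
      · exact Or.inl (Or.inr h)
      · exact Or.inr ⟨x, ⟨t, ht⟩, hx⟩
  · simp only [inr_mem_region, Set.mem_iUnion]

theorem inClosure_univ {T : Set ι} {E : Set P} (h : Buildable k m Γ own q T E)
    (hT : T = Set.univ) (hE : ∀ p, own p = none → p ∈ E) :
    (pieces Γ own q).InClosure k (m + q) Set.univ := by
  refine InClosure.congr h fun v => ⟨fun _ => ?_, fun _ => trivial⟩
  rcases v with p | ⟨x, u⟩
  · rw [inl_mem_region]
    cases hp : own p with
    | none => exact Or.inl (hE p hp)
    | some x => exact Or.inr ⟨x, by simp [hT], hp⟩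
  · rw [inr_mem_region, hT]; trivial

end Buildable

end Blowup

end FinGraph

/-! ### The cube: the logarithmic lower bound for φ -/

namespace FinGraph

section Cube

variable {n h : ℕ}

/-- Pieces are the vertices of a cube, with `h` ports for each coordinate `i`. The `i`-ports of the
two halves of an `(i + 1)`-dimensional face are matched to the `i`-ports of the lowest vertex of
the opposite half. -/
def cubeGraph (n h : ℕ) : SimpleGraph ((Fin n → Bool) × (Fin n × Fin h)) where
  Adj p p' := p.2 = p'.2 ∧ p.1 p.2.1 ≠ p'.1 p.2.1 ∧ (∀ l, p.2.1 < l → p.1 l = p'.1 l) ∧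
    ((∀ l, l < p.2.1 → p.1 l = false) ∨ (∀ l, l < p.2.1 → p'.1 l = false))
  symm := ⟨by
    rintro p p' ⟨h1, h2, h3, h4⟩
    rw [h1] at h2 h3 h4
    exact ⟨h1.symm, h2.symm, fun l hl => (h3 l hl).symm, h4.symm⟩⟩
  loopless := ⟨fun p hp => hp.2.1 rfl⟩

theorem cubeGraph_adj {p p' : (Fin n → Bool) × (Fin n × Fin h)} :
    (cubeGraph n h).Adj p p' ↔ p.2 = p'.2 ∧ p.1 p.2.1 ≠ p'.1 p.2.1 ∧
      (∀ l, p.2.1 < l → p.1 l = p'.1 l) ∧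
      ((∀ l, l < p.2.1 → p.1 l = false) ∨ (∀ l, l < p.2.1 → p'.1 l = false)) := Iff.rfl

/-- The face of the cube through `z` on which the coordinates from `i` on are fixed. -/
def face (i : ℕ) (z : Fin n → Bool) : Set (Fin n → Bool) := {x | ∀ j : Fin n, i ≤ j → x j = z j}

theorem ncard_face_le {i : ℕ} (hi : i ≤ n) (z : Fin n → Bool) : (face i z).ncard ≤ 2 ^ i := by
  have h1 : (Set.univ : Set (Fin i → Bool)).ncard = 2 ^ i := by
    rw [Set.ncard_univ, Nat.card_eq_fintype_card]; simp
  rw [← h1]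
  refine Set.ncard_le_ncard_of_injOn (fun x j => x (Fin.castLE hi j)) (fun _ _ => trivial) ?_
    (Set.toFinite _)
  intro x hx y hy hxy
  funext j
  by_cases hj : i ≤ j
  · rw [hx j hj, hy j hj]
  · have h2 := congrFun hxy ⟨j, by omega⟩
    exact h2

/-- A face is glued from its two halves. Every edge between the halves ends at a port of the lowest
vertex of one of them, so the `2 * h` such ports for the current coordinate form the overlap. Each
has at most one neighbour per vertex of the opposite half, hence at most `k`. -/
theorem buildable_face [NeZero n] [NeZero h] {k m q : ℕ} (hh : 2 * h ≤ k) (hn : 2 ^ (n - 1) ≤ k)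
    (hm : n * h ≤ m) (hq : 0 < q) (hkM : k + 1 ≤ m + q) (i : ℕ) (hi : i ≤ n) (z : Fin n → Bool) :
    Buildable k m (cubeGraph n h) (fun p => some p.1) q (face i z) ∅ := by
  induction i generalizing z with
  | zero =>
    have hf : face 0 z = {z} := by
      ext x
      simp [face, funext_iff]
    refine (Buildable.single hq z ?_).congr hf fun p => by rw [hf]
    · refine le_trans ?_ hm
      have h1 : (Set.univ : Set (Fin n × Fin h)).ncard = n * h := by
        rw [Set.ncard_univ, Nat.card_eq_fintype_card]; simp
      rw [← h1]
      refine Set.ncard_le_ncard_of_injOn (fun p => p.2) (fun _ _ => trivial) ?_ (Set.toFinite _)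
      rintro ⟨x, a⟩ hx ⟨y, b⟩ hy hxy
      simp only [Set.mem_ofPred_eq, Option.some.injEq] at hx hy hxy
      rw [hx, hy, hxy]
  | succ i ih =>
    let I : Fin n := ⟨i, hi⟩
    let zb : Bool → Fin n → Bool := fun b => Function.update z I b
    let low : Bool → Fin n → Bool := fun b j => if j < I then false else zb b j
    let E : Bool → Set ((Fin n → Bool) × (Fin n × Fin h)) := fun b => {p | p.1 = low b ∧ p.2.1 = I}
    have hface : ∀ b x, x ∈ face i (zb b) ↔ x I = b ∧ ∀ j, I < j → x j = z j := by
      intro b x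
      constructor
      · intro hx
        refine ⟨by rw [hx I le_rfl]; simp [zb], fun j hj => ?_⟩
        rw [hx j (le_of_lt hj)]
        simp [zb, hj.ne']
      · rintro ⟨h1, h2⟩ j hj
        rcases hj.eq_or_lt with hj | hj
        · have : j = I := Fin.ext hj.symm
          subst this
          simp [zb, h1]
        · have hj' : I < j := hj
          rw [h2 j hj']
          simp [zb, hj'.ne']
    have hlow : ∀ b, low b ∈ face i (zb b) := by
      intro b j hj
      have : ¬ j < I := not_lt.2 hj
      simp [low, this]
    have hport : ∀ b x, x ∈ face i (zb b) → (∀ l, l < I → x l = false) → x = low b := by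
      intro b x hx hl
      funext j
      by_cases hj : j < I
      · simp [low, hj, hl j hj]
      · rw [hx j (not_lt.1 hj)]; simp [low, hj]
    have hadd : ∀ b, Buildable k m (cubeGraph n h) (fun p => some p.1) q (face i (zb b))
        (∅ ∪ E (!b)) := by
      intro b
      refine (ih (by omega) (zb b)).addPorts hkM (E (!b)) ?_ ?_ ?_
      · rintro p ⟨hp, -⟩ (h1 | ⟨x, hx, h1⟩)
        · exact h1
        · have h2 : p.1 = x := by simpa using h1
          rw [← h2, hp] at hx
          have h3 := ((hface _ _).1 hx).1
          rw [((hface _ _).1 (hlow (!b))).1] at h3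
          cases b <;> simp at h3
      · rintro p ⟨hp, -⟩ p' ⟨hp', -⟩ hadj
        rw [cubeGraph_adj, hp, hp'] at hadj
        exact hadj.2.1 rfl
      · rintro p -
        refine le_trans (Set.ncard_le_ncard_of_injOn (t := face i (zb b)) (fun p' => p'.1) ?_ ?_
          (Set.toFinite _)) ((ncard_face_le (by omega) _).trans
            ((Nat.pow_le_pow_right (by norm_num) (by omega)).trans hn))
        · rintro p' ⟨h1 | ⟨x, hx, h1⟩, -⟩
          · exact absurd h1 (Set.notMem_empty _)
          · have h2 : p'.1 = x := by simpa using h1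
            change p'.1 ∈ _
            rw [h2]; exact hx
        · rintro p₁ ⟨-, h1⟩ p₂ ⟨-, h2⟩ h3
          exact Prod.ext h3 (h1.1.symm.trans h2.1)
    have hEcard : ∀ b, (E b).ncard ≤ h := by
      intro b
      have h1 : (Set.univ : Set (Fin h)).ncard = h := by
        rw [Set.ncard_univ, Nat.card_eq_fintype_card]; simp
      refine le_trans (Set.ncard_le_ncard_of_injOn (t := Set.univ) (fun p => p.2.2)
        (fun _ _ => trivial) ?_ (Set.toFinite _)) h1.le
      rintro ⟨x, a, a'⟩ ⟨hx, ha⟩ ⟨y, b, b'⟩ ⟨hy, hb⟩ hxy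
      simp only at hx ha hy hb hxy
      rw [hx, ha, hy, hb, hxy]
    have hglue := (hadd false).glue (hadd true) (by
      rw [Set.disjoint_left]
      intro x hx hx'
      have h1 := ((hface _ _).1 hx).1
      rw [((hface _ _).1 hx').1] at h1
      cases h1) (by
      rw [Set.empty_union, Set.empty_union]
      refine (Set.ncard_union_le _ _).trans ?_
      have := hEcard (!false)
      have := hEcard (!true)
      omega) (by
      rintro p p' ((⟨⟨⟩⟩ | hp) | ⟨x, hx, hpx⟩) hp' hadj
      · exact Or.inl (Or.inr ⟨_, hlow true, congrArg some hp.1⟩)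
      rcases hp' with (⟨⟨⟩⟩ | hp') | ⟨y, hy, hpy⟩
      · exact Or.inr (Or.inr ⟨_, hlow false, congrArg some hp'.1⟩)
      have h1 : p.1 = x := by simpa using hpx
      have h2 : p'.1 = y := by simpa using hpy
      subst h1 h2
      have hx' := (hface _ _).1 hx
      have hy' := (hface _ _).1 hy
      obtain ⟨e1, e2, e3, e4⟩ := cubeGraph_adj.1 hadj
      -- At a lower coordinate the edge would stay within one half; at a higher one its ends would
      -- lie in different faces.
      have hlev : p.2.1 = I := by
        rcases lt_trichotomy p.2.1 I with hlt | heq | hgt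
        · have := e3 I hlt
          rw [hx'.1, hy'.1] at this
          cases this
        · exact heq
        · exact absurd ((hx'.2 _ hgt).trans (hy'.2 _ hgt).symm) e2
      rw [hlev] at e4
      rcases e4 with e4 | e4
      · exact Or.inl (Or.inl (Or.inr ⟨hport _ _ hx e4, hlev⟩))
      · exact Or.inr (Or.inl (Or.inr ⟨hport _ _ hy e4, e1 ▸ hlev⟩)))
    have hTT : face (i + 1) z = face i (zb false) ∪ face i (zb true) := by
      ext x
      rw [Set.mem_union, hface, hface]
      constructor
      · intro hx
        have : ∀ j, I < j → x j = z j := fun j hj => hx j hj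
        cases hxI : x I
        · exact Or.inl ⟨rfl, this⟩
        · exact Or.inr ⟨rfl, this⟩
      · rintro (⟨-, hx⟩ | ⟨-, hx⟩) <;> exact fun j hj => hx j hj
    refine hglue.congr hTT fun p => ?_
    rw [hTT]
    constructor
    · rintro (⟨⟨⟩⟩ | hp)
      exact Or.inr hp
    · rintro ((((⟨⟨⟩⟩ | hp)) | (⟨⟨⟩⟩ | hp)) | hp)
      · exact Or.inr ⟨_, Or.inr (hlow true), congrArg some hp.1⟩
      · exact Or.inr ⟨_, Or.inl (hlow false), congrArg some hp.1⟩
      · exact Or.inr hp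

theorem mul_le_of_phiBound [NeZero n] [NeZero h] {k : ℕ} (hh : 2 * h ≤ k)
    (hn : 2 ^ (n - 1) ≤ k) {c : ℕ} (hc : PhiBound k c) : n * h ≤ c := by
  have hpos : 0 < n * h := Nat.mul_pos (NeZero.pos n) (NeZero.pos h)
  have hG := (buildable_face (q := n * h + 2 * (n * h) + k) hh hn le_rfl (by omega) (by omega) n
    le_rfl (fun _ => false)).inClosure_univ
    (Set.eq_univ_of_forall fun x j hj => absurd hj (by omega)) (by simp)
  refine le_of_phiBound_of_pieces hpos (by omega) ?_ (by simp) hG hc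
  intro x
  -- The lowest vertex of the half opposite to `x` in direction `i`. All `n * h` ports of `x` are
  -- matched to ports of such vertices.
  let ctr : Fin n → Fin n → Bool := fun i l => if l < i then false else if l = i then !x i else x l
  refine ⟨fun a => (x, finProdFinEquiv.symm a),
    fun a => (ctr (finProdFinEquiv.symm a).1, finProdFinEquiv.symm a), ?_, ?_, ?_⟩
  · intro a b hab
    exact finProdFinEquiv.symm.injective (Prod.ext_iff.1 hab).2
  · intro a b hab
    exact finProdFinEquiv.symm.injective (Prod.ext_iff.1 hab).2
  · intro a
    set i := (finProdFinEquiv.symm a).1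
    have hci : ctr i i = !x i := by simp [ctr]
    refine ⟨rfl, ?_, rfl, ?_, ?_, ?_⟩
    · intro he
      have he' : ctr i = x := Option.some_injective _ he
      rw [he'] at hci
      cases hx : x i <;> simp [hx] at hci
    · change x i ≠ ctr i i
      rw [hci]; cases x i <;> simp
    · intro l hl
      change i < l at hl
      change x l = ctr i l
      simp [ctr, hl.ne', hl.le]
    · right
      intro l hl
      change l < i at hl
      change ctr i l = false
      simp [ctr, hl]

end Cube

end FinGraph

/-! ### The tower: lower bounds k² + k - 1 for ψ and 2k - 1 for φ -/

namespace FinGraph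

theorem ncard_pair_le {β : Type} (a b : β) : ({a, b} : Set β).ncard ≤ 2 :=
  (Set.ncard_insert_le _ _).trans (by rw [Set.ncard_singleton])

theorem card_le_ncard_of_injective {γ β : Type} [Finite β] {S : Set β} (g : γ → β)
    (hg : g.Injective) (h : ∀ z, g z ∈ S) : Nat.card γ ≤ S.ncard := by
  rw [← Set.ncard_univ, ← Set.ncard_image_of_injective _ hg]
  exact Set.ncard_le_ncard (by rintro _ ⟨z, -, rfl⟩; exact h z) (Set.toFinite _)

theorem ncard_le_card_of_injOn {γ β : Type} [Finite γ] {S : Set β} (g : β → γ)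
    (hg : Set.InjOn g S) : S.ncard ≤ Nat.card γ := by
  rw [← Set.ncard_univ]
  exact Set.ncard_le_ncard_of_injOn g (fun _ _ => trivial) hg (Set.toFinite _)

section Star

variable {β D : Type}

/-- Every element of `β` is joined to its centre. -/
def starGraph (ctr : β → D) : SimpleGraph (β ⊕ D) where
  Adj v w := (∃ b, v = .inl b ∧ w = .inr (ctr b)) ∨ (∃ b, w = .inl b ∧ v = .inr (ctr b))
  symm := ⟨fun _ _ h => h.symm⟩
  loopless := ⟨by rintro v (⟨b, rfl, h⟩ | ⟨b, rfl, h⟩) <;> cases h⟩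

theorem starGraph_adj_inr {ctr : β → D} {d : D} {v : β ⊕ D} :
    (starGraph ctr).Adj (.inr d) v ↔ ∃ b, v = .inl b ∧ ctr b = d := by
  constructor
  · rintro (⟨b, h, -⟩ | ⟨b, rfl, h⟩)
    · cases h
    · exact ⟨b, rfl, (Sum.inr_injective h).symm⟩
  · rintro ⟨b, rfl, rfl⟩
    exact Or.inr ⟨b, rfl, rfl⟩

theorem starGraph_adj_inl {ctr : β → D} {b : β} {v : β ⊕ D} :
    (starGraph ctr).Adj (.inl b) v ↔ v = .inr (ctr b) := by
  constructor
  · rintro (⟨b', h, rfl⟩ | ⟨b', -, h⟩)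
    · rw [Sum.inl_injective h]
    · cases h
  · rintro rfl
    exact Or.inl ⟨b, rfl, rfl⟩

end Star

section Tower

variable (N r : ℕ)

/-- The ports of a piece of the tower: a square of blocks and `r` remaining ports. -/
abbrev TowerLabel : Type := Fin (r + 1) × Fin (r + 1) ⊕ Fin r

/-- The pieces of the tower. -/
abbrev TowerPiece : Type := Fin N × Fin (r + 2)

/-- The centres of the tower: `r + 1` for each of the `N` storeys, and `r + 1` common ones. -/
abbrev TowerCenter : Type := Fin N × Fin (r + 1) ⊕ Fin (r + 1)

variable {N r}

/-- The common centre that has no neighbour in the piece `s` of a storey. -/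
def missed : Fin (r + 2) → Fin (r + 1) := Fin.lastCases 0 id

theorem missed_castSucc (i : Fin (r + 1)) : missed i.castSucc = i := by simp [missed]

/-- The centre to which a port of the tower is joined. -/
def towerCenter : TowerPiece N r × TowerLabel r → TowerCenter N r
  | ((t, _), .inl (i, _)) => .inl (t, i)
  | ((_, s), .inr j) => .inr ((missed s).succAbove j)

/-- The piece of a port of the tower. -/
def towerOwner : (TowerPiece N r × TowerLabel r) ⊕ TowerCenter N r → Option (TowerPiece N r)
  | .inl p => some p.1
  | .inr _ => none

/-- The ports of the tower, joined to their centres. -/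
abbrev towerGraph (N r : ℕ) : SimpleGraph ((TowerPiece N r × TowerLabel r) ⊕ TowerCenter N r) :=
  starGraph towerCenter

theorem ncard_towerOwner (x : TowerPiece N r) :
    {p | towerOwner p = some x}.ncard = (r + 1) * (r + 1) + r := by
  have h1 : {p | towerOwner p = some x} =
      (fun a : TowerLabel r => (Sum.inl (x, a) : _ ⊕ TowerCenter N r)) '' Set.univ := by
    ext (⟨y, a⟩ | d)
    · simp [towerOwner, eq_comm]
    · simp [towerOwner]
  rw [h1, Set.ncard_image_of_injective, Set.ncard_univ, Nat.card_eq_fintype_card]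
  · simp
  · intro a b h; simpa using h

/-- With k = r + 1: each of the k centres of a storey has k neighbours in every piece, so these
centres can be added to each piece, and the k + 1 pieces are glued along them. Then the k common
centres are added and the storeys are glued along these. -/
theorem tower_inClosure {q : ℕ} (hq : 0 < q) [NeZero N] :
    (pieces (towerGraph N r) towerOwner q).InClosure (r + 1) ((r + 1) * (r + 1) + r + q)
      Set.univ := by
  have hkM : r + 1 + 1 ≤ (r + 1) * (r + 1) + r + q := by nlinarith
  let mid : Fin N → Set ((TowerPiece N r × TowerLabel r) ⊕ TowerCenter N r) :=
    fun t => Set.range fun i => .inr (.inl (t, i))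
  let top : Set ((TowerPiece N r × TowerLabel r) ⊕ TowerCenter N r) :=
    Set.range fun i => .inr (.inr i)
  have h1 : ∀ t s, Buildable (r + 1) ((r + 1) * (r + 1) + r) (towerGraph N r) towerOwner q
      {(t, s)} (∅ ∪ mid t) := by
    intro t s
    refine (Buildable.single hq (t, s) (ncard_towerOwner _).le).addPorts hkM _ ?_ ?_ ?_
    · rintro _ ⟨i, rfl⟩ (⟨⟨⟩⟩ | ⟨x, -, hx⟩)
      cases hx
    · rintro _ ⟨i, rfl⟩ _ ⟨i', rfl⟩ h
      rw [starGraph_adj_inr] at h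
      obtain ⟨b, h, -⟩ := h
      cases h
    · rintro _ ⟨i, rfl⟩
      have hm : ∀ p', PortIn towerOwner {(t, s)} ∅ p' ∧
          (towerGraph N r).Adj (.inr (.inl (t, i))) p' → ∃ j, p' = .inl ((t, s), .inl (i, j)) := by
        rintro p' ⟨h1, h2⟩
        rw [starGraph_adj_inr] at h2
        obtain ⟨⟨y, a⟩, rfl, h2⟩ := h2
        rcases h1 with ⟨⟨⟩⟩ | ⟨x, rfl, hx⟩
        have hy : y = (t, s) := Option.some_injective _ hx
        subst hy
        rcases a with ⟨i', j⟩ | j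
        · simp only [towerCenter, Sum.inl.injEq, Prod.mk.injEq, true_and] at h2
          exact ⟨j, by rw [h2]⟩
        · simp [towerCenter] at h2
      choose! g hg using hm
      refine (ncard_le_card_of_injOn g ?_).trans (Nat.card_fin _).le
      intro a ha b hb hab
      rw [hg a ha, hg b hb, hab]
  have h2 : ∀ t, Buildable (r + 1) ((r + 1) * (r + 1) + r) (towerGraph N r) towerOwner q
      (⋃ s, {(t, s)}) ((⋃ _ : Fin (r + 2), ∅) ∪ mid t) := by
    intro t
    refine Buildable.iUnion (E := fun _ => ∅) (h1 t) ?_ ?_ ?_ ?_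
    · intro s s' hs
      simpa using hs
    · refine (Set.ncard_le_ncard_of_injOn (t := Set.univ)
        (Sum.elim (fun _ => 0) (Sum.elim (fun p => p.2) id)) (fun _ _ => trivial) ?_
        (Set.toFinite _)).trans (by rw [Set.ncard_univ]; simp)
      rintro _ ⟨i, rfl⟩ _ ⟨i', rfl⟩ h
      simp only [Sum.elim_inr, Sum.elim_inl] at h
      rw [h]
    · rintro s s' hs p (⟨⟨⟩⟩ | ⟨x, rfl, hx⟩) (⟨⟨⟩⟩ | ⟨y, rfl, hy⟩)
      rw [hx] at hy
      simp at hy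
      exact hs hy
    · rintro s s' hs p p' (⟨⟨⟩⟩ | ⟨x, -, hx⟩) (⟨⟨⟩⟩ | ⟨y, -, hy⟩) hadj
      rcases p with p | p
      · rw [starGraph_adj_inl] at hadj
        subst hadj
        cases hy
      · cases hx
  have h3 : ∀ t, Buildable (r + 1) ((r + 1) * (r + 1) + r) (towerGraph N r) towerOwner q
      (⋃ s, {(t, s)}) (mid t ∪ top) := by
    intro t
    have h2' := (h2 t).congr (E' := mid t) rfl fun p => by simp [PortIn]
    refine h2'.addPorts hkM _ ?_ ?_ ?_
    · rintro _ ⟨i, rfl⟩ (⟨i', h⟩ | ⟨x, -, hx⟩)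
      · simp at h
      · cases hx
    · rintro _ ⟨i, rfl⟩ _ ⟨i', rfl⟩ h
      rw [starGraph_adj_inr] at h
      obtain ⟨b, h, -⟩ := h
      cases h
    · rintro _ ⟨i, rfl⟩
      have hm : ∀ p', PortIn towerOwner (⋃ s, {(t, s)}) (mid t) p' ∧
          (towerGraph N r).Adj (.inr (.inr i)) p' → ∃ z : Fin (r + 1), ∃ j : Fin r,
            p' = .inl ((t, i.castSucc.succAbove z), .inr j) ∧
            (missed (i.castSucc.succAbove z)).succAbove j = i := by
        rintro p' ⟨h1, h2⟩
        rw [starGraph_adj_inr] at h2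
        obtain ⟨⟨⟨t', s⟩, a⟩, rfl, h2⟩ := h2
        rcases h1 with ⟨i', h⟩ | ⟨x, hx', hx⟩
        · simp at h
        simp only [Set.iUnion_singleton_eq_range, Set.mem_range] at hx'
        obtain ⟨s', rfl⟩ := hx'
        have hy : (t', s) = (t, s') := Option.some_injective _ hx
        cases hy
        rcases a with ⟨i', j⟩ | j
        · simp [towerCenter] at h2
        · simp only [towerCenter, Sum.inr.injEq] at h2
          -- A storey has r + 2 pieces, but piece `i` misses common centre `i`, which leaves at most
          -- r + 1 neighbours.
          have hs : s ≠ i.castSucc := by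
            rintro rfl
            rw [missed_castSucc] at h2
            exact Fin.succAbove_ne _ _ h2
          obtain ⟨z, rfl⟩ := Fin.exists_succAbove_eq hs
          exact ⟨z, j, rfl, h2⟩
      choose! g hg using hm
      refine (ncard_le_card_of_injOn g ?_).trans (Nat.card_fin _).le
      intro a ha b hb hab
      obtain ⟨j, e1, e2⟩ := hg a ha
      obtain ⟨j', e3, e4⟩ := hg b hb
      rw [← hab] at e3 e4
      rw [e1, e3, Fin.succAbove_right_injective (e2.trans e4.symm)]
  have h4 := Buildable.iUnion h3 ?_ ?_ ?_ ?_
  · refine h4.inClosure_univ ?_ ?_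
    · rw [Set.eq_univ_iff_forall]
      rintro ⟨t, s⟩
      simp
    · rintro (p | ⟨t, i⟩ | i) hp
      · cases hp
      · exact Or.inl (Set.mem_iUnion.2 ⟨t, i, rfl⟩)
      · exact Or.inr ⟨i, rfl⟩
  · intro t t' ht
    rw [Set.disjoint_left]
    intro x hx hx'
    simp only [Set.iUnion_singleton_eq_range, Set.mem_range] at hx hx'
    obtain ⟨s, rfl⟩ := hx
    obtain ⟨s', h⟩ := hx'
    cases h
    exact ht rfl
  · refine (Set.ncard_le_ncard_of_injOn (t := Set.univ)
        (Sum.elim (fun _ => 0) (Sum.elim (fun p => p.2) id)) (fun _ _ => trivial) ?_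
        (Set.toFinite _)).trans (by rw [Set.ncard_univ]; simp)
    rintro _ ⟨i, rfl⟩ _ ⟨i', rfl⟩ h
    simp only [Sum.elim_inr, id_eq] at h
    rw [h]
  · intro t t' ht p hp hp'
    simp only [PortIn, Set.iUnion_singleton_eq_range, mid, Set.mem_range] at hp hp'
    rcases p with ⟨⟨y, s⟩, a⟩ | (⟨y, i⟩ | i) <;> simp [towerOwner] at hp hp'
    · exact ht (by grind)
    · exact ht (by grind)
  · intro t t' ht p p' hp hp' hadj
    simp only [PortIn, Set.iUnion_singleton_eq_range, mid, Set.mem_range] at hp hp'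
    rcases p with ⟨⟨y, s⟩, a⟩ | d
    · rw [starGraph_adj_inl] at hadj
      subst hadj
      rcases a with ⟨i, j⟩ | j <;> simp [towerOwner, towerCenter] at hp hp'
      exact ht (by grind)
    · rw [starGraph_adj_inr] at hadj
      obtain ⟨⟨⟨y, s⟩, a⟩, rfl, rfl⟩ := hadj
      rcases a with ⟨i, j⟩ | j <;> simp [towerOwner, towerCenter] at hp hp'
      exact ht (by grind)

/-- A piece indexed by some i' ≠ i misses i' and is therefore joined to `i`; such an i' exists
because r > 0. One such piece per storey suffices, with one storey to spare for the excluded piece.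
-/
theorem le_ncard_top_neighbors (hr : 0 < r) {c : ℕ} (hN : c + 1 ≤ N) (i : Fin (r + 1))
    (x : TowerPiece N r) :
    c ≤ {p' | (towerGraph N r).Adj (.inr (.inr i)) p' ∧ towerOwner p' ≠ none ∧
      towerOwner p' ≠ some x}.ncard := by
  have : Nontrivial (Fin (r + 1)) := Fin.nontrivial_iff_two_le.2 (by omega)
  obtain ⟨i', hi'⟩ := exists_ne i
  obtain ⟨j, hj⟩ := Fin.exists_succAbove_eq hi'.symm
  refine le_ncard_neighbors_off_piece (γ := Fin N) (by simpa using hN)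
    (fun t => .inl ((t, i'.castSucc), .inr j)) (fun t => (t, i'.castSucc)) ?_ ?_ x
  · intro t t' h; exact (Prod.ext_iff.1 h).1
  · intro t
    refine ⟨rfl, ?_⟩
    rw [starGraph_adj_inr]
    refine ⟨_, rfl, ?_⟩
    simp [towerCenter, missed_castSucc, hj]

/-- A piece has k² ports to storey centres and k - 1 to common ones, and each port has its centre
outside the piece. A storey centre has degree k(k + 1), and enough storeys serve the common centres.
-/
theorem le_of_psiBound {k c : ℕ} (hk : 2 ≤ k) (h : PsiBound k c) : k ^ 2 + k - 1 ≤ c := by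
  obtain ⟨r, rfl⟩ : ∃ r, k = r + 1 := ⟨k - 1, by omega⟩
  let m := (r + 1) * (r + 1) + r
  have hm : m = (r + 1) ^ 2 + (r + 1) - 1 := by simp only [m, pow_two]; omega
  rw [← hm]
  have hG := tower_inClosure (N := m + 1) (r := r) (q := m + 1) (by omega)
  refine le_of_psiBound_of_pieces (m := m) (by simp only [m]; omega) le_rfl ncard_towerOwner ?_ ?_
    hG h
  · rintro (p | d) x hx
    · exact ⟨.inr (towerCenter p), by simp [towerOwner], starGraph_adj_inl.2 rfl⟩
    · cases hx
  · rintro (p | ⟨t, i⟩ | i) hp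
    · cases hp
    · refine le_trans ?_ (card_le_ncard_of_injective
        (fun z : Fin (r + 2) × Fin (r + 1) => .inl ((t, z.1), .inl (i, z.2))) ?_ ?_)
      · rw [Nat.card_eq_fintype_card]
        simp only [Fintype.card_prod, Fintype.card_fin, m]
        nlinarith
      · rintro ⟨a, b⟩ ⟨a', b'⟩ h
        simpa using h
      · rintro ⟨a, b⟩
        refine ⟨starGraph_adj_inr.2 ⟨_, rfl, rfl⟩, by simp [towerOwner]⟩
    · refine (le_ncard_top_neighbors (by omega) le_rfl i (0, 0)).trans
        (Set.ncard_le_ncard ?_ (Set.toFinite _))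
      exact fun p hp => ⟨hp.1, hp.2.1⟩

/-- For φ only distinct far ends count: a piece reaches k storey centres and k - 1 common ones.
Outside any given piece a storey centre still has k² ≥ 2k - 1 neighbours. -/
theorem le_of_phiBound {k c : ℕ} (hk : 2 ≤ k) (h : PhiBound k c) : 2 * k - 1 ≤ c := by
  obtain ⟨r, rfl⟩ : ∃ r, k = r + 1 := ⟨k - 1, by omega⟩
  have hm : 2 * (r + 1) - 1 = (r + 1) + r := by omega
  rw [hm]
  have hG := tower_inClosure (N := r + 1 + r + 1) (r := r)
    (q := (r + 1) * (r + 1) + r + 2 * (r + 1 + r)) (by omega)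
  refine le_of_phiBound_of_pieces (c := r + 1 + r) (by omega) le_rfl ?_ ?_ hG h
  · intro x
    let g : Fin (r + 1) ⊕ Fin r →
        (TowerPiece (r + 1 + r + 1) r × TowerLabel r) ⊕ TowerCenter (r + 1 + r + 1) r :=
      Sum.elim (fun i => .inl (x, .inl (i, 0))) (fun j => .inl (x, .inr j))
    let f : Fin (r + 1) ⊕ Fin r →
        (TowerPiece (r + 1 + r + 1) r × TowerLabel r) ⊕ TowerCenter (r + 1 + r + 1) r :=
      Sum.elim (fun i => .inr (.inl (x.1, i))) (fun j => .inr (.inr ((missed x.2).succAbove j)))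
    refine ⟨g ∘ finSumFinEquiv.symm, f ∘ finSumFinEquiv.symm, ?_, ?_, fun a => ?_⟩
    · refine Function.Injective.comp ?_ (Equiv.injective _)
      rintro (a | a) (b | b) hab <;> simp [g] at hab <;> rw [hab]
    · refine Function.Injective.comp ?_ (Equiv.injective _)
      rintro (a | a) (b | b) hab <;> simp [f] at hab <;> rw [hab]
    · simp only [Function.comp_apply]
      rcases finSumFinEquiv.symm a with i | j
      · exact ⟨rfl, by simp [f, towerOwner], starGraph_adj_inl.2 rfl⟩
      · exact ⟨rfl, by simp [f, towerOwner], starGraph_adj_inl.2 rfl⟩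
  · rintro (p | ⟨t, i⟩ | i) hp x
    · cases hp
    · refine le_trans ?_ (card_le_ncard_of_injective
        (fun z : Fin (r + 1) × Fin (r + 1) => .inl ((t, x.2.succAbove z.1), .inl (i, z.2))) ?_ ?_)
      · rw [Nat.card_eq_fintype_card]
        simp only [Fintype.card_prod, Fintype.card_fin]
        nlinarith
      · rintro ⟨a, b⟩ ⟨a', b'⟩ h
        simpa using h
      · rintro ⟨a, b⟩
        refine ⟨starGraph_adj_inr.2 ⟨_, rfl, rfl⟩, by simp [towerOwner], ?_⟩
        simp only [towerOwner, ne_eq, Option.some.injEq]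
        intro h
        have := congrArg Prod.snd h
        exact Fin.succAbove_ne _ _ this
    · exact le_ncard_top_neighbors (by omega) le_rfl i x

end Tower

end FinGraph

/-! ### Storeys of triads: φ(2) ≥ 5 -/

namespace FinGraph

section Triad

/-- Adjacency of the ports `(y, a)` of three pieces `y` that form a unit. -/
def unitAdj (z w : Fin 3 × Fin 5) : Bool :=
  (z.1 != 2 && w.1 != 2 && z.1 != w.1 && z.2 == w.2 && decide (z.2.val < 2)) ||
  (z.1 == 2 && w.1 != 2 && decide (z.2.val < 2) && w.2.val == z.2.val + 2) ||
  (w.1 == 2 && z.1 != 2 && decide (w.2.val < 2) && z.2.val == w.2.val + 2)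

/-- The centres `0`, `1` of a storey are joined to two ports of every unit of the storey. -/
def midAdj (z : Fin 3 × Fin 5) (i : Fin 2) : Bool :=
  (z.1 == i.castSucc && z.2 == 4) || (z.1 == 2 && z.2.val == i.val + 2)

/-- The common centre that is joined to the unit `s` of every storey. -/
def topOf (s : Fin 3) : Fin 2 := if s = 2 then 1 else 0

/-- The ports of the pieces `y` of the units `s` of the storeys `t`, and the centres. -/
abbrev TriadPort (N : ℕ) : Type := ((Fin N × Fin 3 × Fin 3) × Fin 5) ⊕ (Fin N × Fin 2 ⊕ Fin 2)

variable {N : ℕ}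

/-- Adjacency of a port of a piece and a centre. -/
def centerAdj (p : (Fin N × Fin 3 × Fin 3) × Fin 5) : Fin N × Fin 2 ⊕ Fin 2 → Prop
  | .inl (t, i) => p.1.1 = t ∧ midAdj (p.1.2.2, p.2) i
  | .inr i => (p.1.2.2, p.2) = (2, 4) ∧ topOf p.1.2.1 = i

theorem unitAdj_symm : ∀ z w, unitAdj z w = unitAdj w z := by decide

theorem unitAdj_irrefl : ∀ z, ¬ unitAdj z z := by decide

/-- Adjacency of two ports of pieces. -/
def innerAdj (p p' : (Fin N × Fin 3 × Fin 3) × Fin 5) : Prop :=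
  p.1.1 = p'.1.1 ∧ p.1.2.1 = p'.1.2.1 ∧ unitAdj (p.1.2.2, p.2) (p'.1.2.2, p'.2)

/-- Storeys made of three units of three pieces, and their centres. -/
def triadGraph (N : ℕ) : SimpleGraph (TriadPort N) where
  Adj
    | .inl p, .inl p' => innerAdj p p'
    | .inl p, .inr d => centerAdj p d
    | .inr d, .inl p => centerAdj p d
    | .inr _, .inr _ => False
  symm := ⟨by
    rintro (p | d) (p' | d') h
    · exact ⟨h.1.symm, h.2.1.symm, by rw [unitAdj_symm]; exact h.2.2⟩
    · exact h
    · exact h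
    · exact h⟩
  loopless := ⟨by
    rintro (p | d) h
    · exact unitAdj_irrefl _ h.2.2
    · exact h⟩

/-- The piece of a port. -/
def triadOwner : TriadPort N → Option (Fin N × Fin 3 × Fin 3)
  | .inl p => some p.1
  | .inr _ => none

theorem ncard_triadOwner_le (x : Fin N × Fin 3 × Fin 3) :
    {p | triadOwner p = some x}.ncard ≤ 5 := by
  refine (Set.ncard_le_ncard_of_injOn (t := (Set.univ : Set (Fin 5)))
    (Sum.elim (fun p => p.2) (fun _ => 0)) (fun _ _ => trivial) ?_ (Set.toFinite _)).trans
    (by rw [Set.ncard_univ]; simp)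
  rintro (⟨y, a⟩ | d) hp (⟨y', a'⟩ | d') hp' h
  · cases hp; cases hp'
    simp only [Sum.elim_inl] at h
    rw [h]
  · cases hp'
  · cases hp
  · cases hp

theorem buildable_insert_piece {q : ℕ} (t : Fin N) (s : Fin 3) (Y : Finset (Fin 3)) (y₀ : Fin 3)
    (hY : Buildable 2 5 (triadGraph N) triadOwner q {x | ∃ y ∈ Y, x = (t, s, y)} ∅)
    (hy₀ : y₀ ∉ Y) (hq : 0 < q)
    (hd : ∀ a : Fin 5, a.val < 2 →
      (Finset.univ.filter fun z : Fin 3 × Fin 5 => z.1 ∈ Y ∧ unitAdj (y₀, a) z).card ≤ 2)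
    (hind : ∀ a b : Fin 5, ¬ unitAdj (y₀, a) (y₀, b))
    (hcross : ∀ y ∈ Y, ∀ a b : Fin 5, unitAdj (y, b) (y₀, a) → a.val < 2) :
    Buildable 2 5 (triadGraph N) triadOwner q {x | ∃ y ∈ insert y₀ Y, x = (t, s, y)} ∅ := by
  -- By `hcross` all edges from the new piece to the old ones leave through its ports 0 and 1. These
  -- are added first, each with at most two neighbours, and the piece is glued on along them.
  let E : Set (TriadPort N) := {p | ∃ a : Fin 5, a.val < 2 ∧ p = .inl ((t, s, y₀), a)}
  have hE : E.ncard ≤ 2 := by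
    refine (Set.ncard_le_ncard (t := {.inl ((t, s, y₀), 0), .inl ((t, s, y₀), 1)}) ?_
      (Set.toFinite _)).trans (ncard_pair_le _ _)
    rintro _ ⟨a, ha, rfl⟩
    have : a = 0 ∨ a = 1 := by fin_cases a <;> simp at ha ⊢
    rcases this with rfl | rfl <;> simp
  have h1 : Buildable 2 5 (triadGraph N) triadOwner q {x | ∃ y ∈ Y, x = (t, s, y)} (∅ ∪ E) := by
    refine hY.addPorts (by omega) E ?_ ?_ ?_
    · rintro _ ⟨a, -, rfl⟩ (⟨⟨⟩⟩ | ⟨x, ⟨y, hy, rfl⟩, hx⟩)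
      cases hx
      exact hy₀ hy
    · rintro _ ⟨a, -, rfl⟩ _ ⟨b, -, rfl⟩ h
      exact hind a b h.2.2
    · rintro _ ⟨a, ha, rfl⟩
      refine le_trans ?_ (hd a ha)
      rw [← Set.ncard_coe_finset]
      refine Set.ncard_le_ncard_of_injOn (Sum.elim (fun p => (p.1.2.2, p.2)) fun _ => (0, 0)) ?_ ?_
        (Set.toFinite _)
      · rintro p ⟨⟨⟨⟩⟩ | ⟨x, ⟨y, hy, rfl⟩, hx⟩, hadj⟩
        rcases p with ⟨x, b⟩ | d
        · cases hx
          simpa using And.intro hy hadj.2.2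
        · cases hx
      · rintro p ⟨⟨⟨⟩⟩ | ⟨x, ⟨y, hy, rfl⟩, hx⟩, -⟩ p' ⟨⟨⟨⟩⟩ | ⟨x', ⟨y', hy', rfl⟩, hx'⟩, -⟩ h
        rcases p with ⟨x, b⟩ | d
        · rcases p' with ⟨x', b'⟩ | d'
          · cases hx; cases hx'
            simp only [Sum.elim_inl, Prod.mk.injEq] at h
            rw [h.1, h.2]
          · cases hx'
        · cases hx
  have h2 := h1.glue (Buildable.single hq (t, s, y₀) (ncard_triadOwner_le _)) (by
    rw [Set.disjoint_singleton_right]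
    rintro ⟨y, hy, h⟩
    cases h
    exact hy₀ hy) (by simpa using hE) (by
    rintro p p' ((⟨⟨⟩⟩ | ⟨a, -, rfl⟩) | ⟨x, ⟨y, hy, rfl⟩, hx⟩) (⟨⟨⟩⟩ | ⟨x', rfl, hx'⟩) hadj
    · exact Or.inl (Or.inr ⟨_, rfl, rfl⟩)
    · rcases p with ⟨x, b⟩ | d
      · rcases p' with ⟨x', b'⟩ | d'
        · cases hx; cases hx'
          exact Or.inr (Or.inl (Or.inr ⟨b', hcross y hy b' b hadj.2.2, rfl⟩))
        · cases hx'
      · cases hx)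
  have hset : {x | ∃ y ∈ insert y₀ Y, x = (t, s, y)} =
      {x : Fin N × Fin 3 × Fin 3 | ∃ y ∈ Y, x = (t, s, y)} ∪ {(t, s, y₀)} := by
    ext x
    simp
  refine h2.congr hset fun p => ?_
  rw [hset]
  constructor
  · rintro (⟨⟨⟩⟩ | h)
    exact Or.inr h
  · rintro (((⟨⟨⟩⟩ | ⟨a, -, rfl⟩) | ⟨⟨⟩⟩) | h)
    · exact Or.inr ⟨_, Or.inr rfl, rfl⟩
    · exact Or.inr h

theorem buildable_unit {q : ℕ} (t : Fin N) (s : Fin 3) (hq : 0 < q) :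
    Buildable 2 5 (triadGraph N) triadOwner q {x | ∃ y : Fin 3, x = (t, s, y)} ∅ := by
  have h0 : Buildable 2 5 (triadGraph N) triadOwner q
      {x | ∃ y ∈ ({0} : Finset (Fin 3)), x = (t, s, y)} ∅ := by
    have hset : {x | ∃ y ∈ ({0} : Finset (Fin 3)), x = (t, s, y)} =
      ({(t, s, 0)} : Set (Fin N × Fin 3 × Fin 3)) := by ext x; simp
    exact (Buildable.single hq (t, s, 0) (ncard_triadOwner_le _)).congr hset
      fun p => by rw [hset]
  have h1 := buildable_insert_piece t s {0} 1 h0 (by decide) hq (by decide) (by decide) (by decide)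
  have h2 := buildable_insert_piece t s _ 2 h1 (by decide) hq (by decide) (by decide) (by decide)
  have hset : {x | ∃ y : Fin 3, x = (t, s, y)} =
      {x : Fin N × Fin 3 × Fin 3 | ∃ y ∈ ({2, 1, 0} : Finset (Fin 3)), x = (t, s, y)} := by
    have h : ∀ y : Fin 3, y ∈ ({2, 1, 0} : Finset (Fin 3)) := by decide
    ext x
    simp only [Set.mem_ofPred_eq, h, true_and]
  exact h2.congr hset fun p => by rw [hset]

theorem card_midAdj_le : ∀ i, (Finset.univ.filter fun z => midAdj z i).card ≤ 2 := by decide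

theorem card_topOf_le : ∀ i, (Finset.univ.filter fun s => topOf s = i).card ≤ 2 := by decide

/-- Each storey centre has at most two neighbours in every unit, and each common centre at most two
in every storey; so units are glued along the two storey centres, and storeys along the two common
centres. -/
theorem triad_inClosure {q : ℕ} (hq : 0 < q) [NeZero N] :
    (pieces (triadGraph N) triadOwner q).InClosure 2 (5 + q) Set.univ := by
  let mid : Fin N → Set (TriadPort N) := fun t => Set.range fun i => .inr (.inl (t, i))
  let top : Set (TriadPort N) := Set.range fun i => .inr (.inr i)
  have h1 : ∀ t s, Buildable 2 5 (triadGraph N) triadOwner q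
      {x | ∃ y : Fin 3, x = (t, s, y)} (∅ ∪ mid t) := by
    intro t s
    refine (buildable_unit t s hq).addPorts (by omega) _ ?_ ?_ ?_
    · rintro _ ⟨i, rfl⟩ (⟨⟨⟩⟩ | ⟨x, -, hx⟩)
      cases hx
    · rintro _ ⟨i, rfl⟩ _ ⟨i', rfl⟩ h
      exact h
    · rintro _ ⟨i, rfl⟩
      refine le_trans ?_ (card_midAdj_le i)
      rw [← Set.ncard_coe_finset]
      refine Set.ncard_le_ncard_of_injOn (Sum.elim (fun p => (p.1.2.2, p.2)) fun _ => (0, 0)) ?_ ?_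
        (Set.toFinite _)
      · rintro p ⟨⟨⟨⟩⟩ | ⟨x, ⟨y, rfl⟩, hx⟩, hadj⟩
        rcases p with ⟨x, b⟩ | d
        · cases hx
          simpa using hadj.2
        · cases hx
      · rintro p ⟨⟨⟨⟩⟩ | ⟨x, ⟨y, rfl⟩, hx⟩, -⟩ p' ⟨⟨⟨⟩⟩ | ⟨x', ⟨y', rfl⟩, hx'⟩, -⟩ h
        rcases p with ⟨x, b⟩ | d
        · rcases p' with ⟨x', b'⟩ | d'
          · cases hx; cases hx'
            simp only [Sum.elim_inl, Prod.mk.injEq] at h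
            rw [h.1, h.2]
          · cases hx'
        · cases hx
  have h2 : ∀ t, Buildable 2 5 (triadGraph N) triadOwner q
      (⋃ s : Fin 3, {x | ∃ y : Fin 3, x = (t, s, y)}) ((⋃ _ : Fin 3, ∅) ∪ mid t) := by
    intro t
    refine Buildable.iUnion (E := fun _ => ∅) (h1 t) ?_ ?_ ?_ ?_
    · intro s s' hs
      rw [Set.disjoint_left]
      rintro _ ⟨y, rfl⟩ ⟨y', h⟩
      cases h
      exact hs rfl
    · exact (Set.ncard_le_ncard (t := {.inr (.inl (t, 0)), .inr (.inl (t, 1))}) (by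
        rintro _ ⟨i, rfl⟩
        fin_cases i <;> simp) (Set.toFinite _)).trans (ncard_pair_le _ _)
    · rintro s s' hs p (⟨⟨⟩⟩ | ⟨_, ⟨y, rfl⟩, hx⟩) (⟨⟨⟩⟩ | ⟨_, ⟨y', rfl⟩, hy⟩)
      rw [hx] at hy
      cases hy
      exact hs rfl
    · rintro s s' hs (p | p) (p' | p') (⟨⟨⟩⟩ | ⟨_, ⟨y, rfl⟩, hx⟩) (⟨⟨⟩⟩ | ⟨_, ⟨y', rfl⟩, hy⟩) hadj
      · obtain ⟨x, a⟩ := p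
        obtain ⟨x', a'⟩ := p'
        cases hx; cases hy
        exact hs hadj.2.1
      · cases hy
      · cases hx
      · cases hx
  have h3 : ∀ t, Buildable 2 5 (triadGraph N) triadOwner q
      (⋃ s : Fin 3, {x | ∃ y : Fin 3, x = (t, s, y)}) (mid t ∪ top) := by
    intro t
    have h2' := (h2 t).congr (E' := mid t) rfl fun p => by simp [PortIn]
    refine h2'.addPorts (by omega) _ ?_ ?_ ?_
    · rintro _ ⟨i, rfl⟩ (⟨i', h⟩ | ⟨x, -, hx⟩)
      · simp at h
      · cases hx
    · rintro _ ⟨i, rfl⟩ _ ⟨i', rfl⟩ h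
      exact h
    · rintro _ ⟨i, rfl⟩
      refine le_trans ?_ (card_topOf_le i)
      rw [← Set.ncard_coe_finset]
      refine Set.ncard_le_ncard_of_injOn (Sum.elim (fun p => p.1.2.1) fun _ => 0) ?_ ?_
        (Set.toFinite _)
      · rintro (p | d) ⟨-, hadj⟩
        · simpa using hadj.2
        · exact hadj.elim
      · rintro (⟨⟨x, s, y⟩, a⟩ | d) ⟨h1, hadj⟩ (⟨⟨x', s', y'⟩, a'⟩ | d') ⟨h1', hadj'⟩ h
        · obtain ⟨h2, h3⟩ := Prod.mk.inj hadj.1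
          obtain ⟨h2', h3'⟩ := Prod.mk.inj hadj'.1
          rcases h1 with ⟨i', h1⟩ | ⟨_, hx, h1⟩
          · cases h1
          rcases h1' with ⟨i', h1'⟩ | ⟨_, hx', h1'⟩
          · cases h1'
          rw [Set.mem_iUnion] at hx hx'
          obtain ⟨_, _, rfl⟩ := hx
          obtain ⟨_, _, rfl⟩ := hx'
          cases h1; cases h1'
          simp only at h2 h3 h2' h3'
          subst h2 h3 h2' h3'
          simp only [Sum.elim_inl] at h
          rw [h]
        · exact hadj'.elim
        · exact hadj.elim
        · exact hadj.elim
  have h4 := Buildable.iUnion h3 ?_ ?_ ?_ ?_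
  · refine h4.inClosure_univ ?_ ?_
    · rw [Set.eq_univ_iff_forall]
      rintro ⟨t, s, y⟩
      simp
    · rintro (p | ⟨t, i⟩ | i) hp
      · cases hp
      · exact Or.inl (Set.mem_iUnion.2 ⟨t, i, rfl⟩)
      · exact Or.inr ⟨i, rfl⟩
  · intro t t' ht
    rw [Set.disjoint_left]
    intro x hx hx'
    rw [Set.mem_iUnion] at hx hx'
    obtain ⟨s, y, rfl⟩ := hx
    obtain ⟨s', y', h⟩ := hx'
    cases h
    exact ht rfl
  · exact (Set.ncard_le_ncard (t := {.inr (.inr 0), .inr (.inr 1)}) (by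
        rintro _ ⟨i, rfl⟩
        fin_cases i <;> simp) (Set.toFinite _)).trans (ncard_pair_le _ _)
  · intro t t' ht p hp hp'
    simp only [PortIn, Set.mem_iUnion, mid, Set.mem_range, Set.mem_ofPred_eq] at hp hp'
    rcases p with ⟨⟨y, s⟩, a⟩ | (⟨y, i⟩ | i) <;> simp [triadOwner] at hp hp'
    · exact ht (by grind)
    · exact ht (by grind)
  · intro t t' ht p p' hp hp' hadj
    simp only [PortIn, Set.mem_iUnion, mid, Set.mem_range, Set.mem_ofPred_eq] at hp hp'
    rcases p with ⟨⟨y, s⟩, a⟩ | (⟨y, i⟩ | i) <;>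
      rcases p' with ⟨⟨y', s'⟩, a'⟩ | (⟨y', i'⟩ | i') <;>
      simp [triadOwner] at hp hp' <;>
      first | exact False.elim hadj | (have h := hadj.1; simp at h; exact ht (by grind))

theorem five_le_of_phiBound_two {c : ℕ} (h : PhiBound 2 c) : 5 ≤ c := by
  -- Six storeys give every common centre neighbours in six pieces, one more than needed; 15 = m +
  -- 2c with m = c = 5.
  have hG := triad_inClosure (N := 6) (q := 15) (by norm_num)
  refine le_of_phiBound_of_pieces (c := 5) (m := 5) (by norm_num) (by norm_num) ?_ ?_ hG h
  · rintro ⟨t, s, y⟩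
    let f : Fin 3 → Fin 5 → TriadPort 6 := ![
      ![.inl ((t, s, 1), 0), .inl ((t, s, 1), 1), .inl ((t, s, 2), 0), .inl ((t, s, 2), 1),
        .inr (.inl (t, 0))],
      ![.inl ((t, s, 0), 0), .inl ((t, s, 0), 1), .inl ((t, s, 2), 0), .inl ((t, s, 2), 1),
        .inr (.inl (t, 1))],
      ![.inl ((t, s, 0), 2), .inl ((t, s, 0), 3), .inr (.inl (t, 0)), .inr (.inl (t, 1)),
        .inr (.inr (topOf s))]]
    refine ⟨fun a => .inl ((t, s, y), a), f y, ?_, ?_, ?_⟩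
    · intro a b hab; simpa using hab
    · intro a b hab
      fin_cases y <;> fin_cases a <;> fin_cases b <;> first | rfl | (simp [f] at hab)
    · intro a
      refine ⟨rfl, ?_, ?_⟩
      · fin_cases y <;> fin_cases a <;> simp [f, triadOwner]
      · fin_cases y <;> fin_cases a <;>
          simp [f, triadGraph, innerAdj, centerAdj, unitAdj, midAdj]
  · rintro (p | ⟨t, i⟩ | i) hp x
    · cases hp
    -- Three units with two neighbours each put the six neighbours of a storey centre in distinct
    -- pieces.
    · refine le_ncard_neighbors_off_piece (γ := Fin 3 × Fin 2) (by simp)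
        (fun z => .inl ((t, z.1, if z.2 = 0 then i.castSucc else 2),
          if z.2 = 0 then 4 else i.castLE (by norm_num) + 2))
        (fun z => (t, z.1, if z.2 = 0 then i.castSucc else 2)) ?_ ?_ x
      · rintro ⟨s, b⟩ ⟨s', b'⟩ h
        simp only [Prod.mk.injEq, true_and] at h ⊢
        refine ⟨h.1, ?_⟩
        replace h := h.2
        clear hp
        fin_cases i <;> fin_cases b <;> fin_cases b' <;> first | rfl | simp at h
      · rintro ⟨s, b⟩
        refine ⟨rfl, rfl, ?_⟩
        simp only
        clear hp
        fin_cases i <;> fin_cases b <;> rfl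
    · refine le_ncard_neighbors_off_piece (γ := Fin 6) (by simp)
        (fun t => .inl ((t, if i = 0 then 0 else 2, 2), 4))
        (fun t => (t, if i = 0 then 0 else 2, 2)) ?_ ?_ x
      · intro t t' h; exact (Prod.ext_iff.1 h).1
      · intro t
        refine ⟨rfl, rfl, ?_⟩
        fin_cases i <;> rfl

end Triad

end FinGraph

/-! ### The case k = 1, the logarithmic form, and the conclusion -/

namespace FinGraph

/-- The three-vertex path is two edges glued at a vertex. It is too large for the class of graphs on
at most two vertices, and being connected it has no cut-partition with empty `C`. -/
theorem one_le_of_phiBound_one {c : ℕ} (h : PhiBound 1 c) : 1 ≤ c := by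
  let G : FinGraph := ⟨Fin 3, inferInstance, inferInstance, SimpleGraph.pathGraph 3⟩
  have h01 : (SimpleGraph.pathGraph 3).Adj 0 1 := by simp [SimpleGraph.pathGraph_adj]
  have h12 : (SimpleGraph.pathGraph 3).Adj 1 2 := by simp [SimpleGraph.pathGraph_adj]
  have h02 : ¬ (SimpleGraph.pathGraph 3).Adj 0 2 := by simp [SimpleGraph.pathGraph_adj]
  have hG : G.InClosure 1 2 Set.univ := by
    have h1 : G.InClosure 1 2 ({0, 1} : Set (Fin 3)) :=
      InClosure.of_ncard_le ⟨0, by simp⟩ (ncard_pair_le _ _)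
    have h2 : G.InClosure 1 2 ({1, 2} : Set (Fin 3)) :=
      InClosure.of_ncard_le ⟨1, by simp⟩ (ncard_pair_le _ _)
    refine (h1.union h2 ?_ ?_).congr ?_
    · have : ({0, 1} ∩ {1, 2} : Set (Fin 3)) ⊆ {1} := by
        intro x; fin_cases x <;> simp
      refine (Set.ncard_le_ncard this (Set.toFinite _)).trans ?_
      rw [Set.ncard_singleton]
    · rintro u (rfl | rfl) v (rfl | rfl) huv
      · exact Or.inr (Or.inr rfl)
      · exact absurd huv h02
      · exact Or.inl (Or.inl rfl)
      · exact Or.inl (Or.inl rfl)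
    · intro v
      fin_cases v <;> simp
  rcases h _ (hereditary_smallGraphs 2) _ hG.kClosure with hs | ⟨A, B, C, hp, -, hC⟩
  · have h3 : Nat.card (Fin 3) ≤ 2 := hs
    simp at h3
  · by_contra hc
    have hC0 : C = ∅ := by
      have := G.finite
      rw [← Set.ncard_eq_zero (Set.toFinite _)]; omega
    have hAB : ∀ v : Fin 3, v ∈ A ∨ v ∈ B := by
      intro v
      have hv : v ∈ A ∪ B ∪ C := by rw [hp.union_eq]; trivial
      simpa [hC0] using hv
    have hd := Set.disjoint_left.1 hp.disjoint_left_right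
    have hstep : ∀ u v : Fin 3, (SimpleGraph.pathGraph 3).Adj u v → (u ∈ A ↔ v ∈ A) := by
      intro u v huv
      constructor
      · intro hu
        exact (hAB v).resolve_right fun hv => hp.anticomplete u hu v hv huv
      · intro hv
        exact (hAB u).resolve_right fun hu => hp.anticomplete v hv u hu huv.symm
    have e1 := hstep _ _ h01
    have e2 := hstep _ _ h12
    have hall : ∀ u v : Fin 3, u ∈ A → v ∈ A := by
      intro u v
      fin_cases u <;> fin_cases v <;> simp <;> tauto
    obtain ⟨a, ha⟩ := hp.nonempty_left
    obtain ⟨b, hb⟩ := hp.nonempty_right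
    exact hd (hall a b ha) hb

theorem logb_lt_of_phiBound {k c : ℕ} (hk : 0 < k) (h : PhiBound k c) :
    (1 / 4 : ℝ) * k * Real.logb 2 k < c := by
  rcases (by omega : 1 < k ∨ k = 1) with hk2 | hk1
  · have hne : NeZero (k / 2) := ⟨by omega⟩
    -- The largest values the cube allows: 2^(n-1) ≤ k and 2h ≤ k. Rounding costs at most a factor 2
    -- in h, so h ≥ k/4, while n exceeds log₂ k strictly.
    have h1 := mul_le_of_phiBound (n := Nat.log 2 k + 1) (h := k / 2) (k := k) (by omega)
      (by simpa using Nat.pow_log_le_self 2 hk.ne') h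
    have h2 : Real.logb 2 k < (Nat.log 2 k + 1 : ℕ) := by
      rw [Real.logb_lt_iff_lt_rpow (by norm_num) (by exact_mod_cast hk), Real.rpow_natCast]
      exact_mod_cast Nat.lt_pow_succ_log_self (by norm_num) k
    have h3 : (k : ℝ) ≤ 4 * (k / 2 : ℕ) := by
      have : k ≤ 4 * (k / 2) := by omega
      exact_mod_cast this
    have h4 : ((Nat.log 2 k + 1 : ℕ) : ℝ) * (k / 2 : ℕ) ≤ c := by exact_mod_cast h1
    have hkpos : (0 : ℝ) < k := by exact_mod_cast hk
    have hn : (0 : ℝ) ≤ (Nat.log 2 k + 1 : ℕ) := by positivity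
    calc (1 / 4 : ℝ) * k * Real.logb 2 k < (1 / 4 : ℝ) * k * (Nat.log 2 k + 1 : ℕ) :=
          mul_lt_mul_of_pos_left h2 (by positivity)
      _ ≤ ((Nat.log 2 k + 1 : ℕ) : ℝ) * (k / 2 : ℕ) := by nlinarith
      _ ≤ c := h4
  · subst hk1
    have := one_le_of_phiBound_one h
    simp only [Nat.cast_one, Real.logb_one, mul_zero]
    exact_mod_cast this

end FinGraph

theorem mainTheorem3 :
    (∀ k : ℕ, 0 < k →
      -- the minima that define the three functions exist
      (IsLeast {c | FinGraph.PhiBound k c} (FinGraph.phi k) ∧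
        IsLeast {c | FinGraph.PsiBound k c} (FinGraph.psi k) ∧
        IsLeast {c | FinGraph.PsiCBound k c} (FinGraph.psiC k)) ∧
      (2 * k - 1 ≤ FinGraph.phi k ∧ FinGraph.phi k ≤ FinGraph.psi k ∧
        FinGraph.psi k ≤ FinGraph.psiC k ∧ FinGraph.psiC k ≤ 2 * k ^ 2 - 1) ∧
      (k ^ 2 + k - 1 ≤ FinGraph.psi k ∧ FinGraph.psi k ≤ FinGraph.psiC k ∧
        FinGraph.psiC k ≤ 2 * k ^ 2 - 1) ∧
      ((1 / 4 : ℝ) * (k : ℝ) * Real.logb 2 (k : ℝ) < (FinGraph.phi k : ℝ) ∧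
        FinGraph.phi k ≤ 2 * k ^ 2 - 1)) ∧
    (FinGraph.phi 2 = 5 ∧ FinGraph.psi 2 = 5 ∧ FinGraph.psiC 2 = 5) := by
  have hC : ∀ k, 0 < k → IsLeast {c | FinGraph.PsiCBound k c} (FinGraph.psiC k) := fun k hk =>
    ⟨Nat.sInf_mem ⟨_, FinGraph.psiCBound_two_mul_sq_sub_one hk⟩, fun _ h => Nat.sInf_le h⟩
  have hP : ∀ k, 0 < k → IsLeast {c | FinGraph.PsiBound k c} (FinGraph.psi k) := fun k hk =>
    ⟨Nat.sInf_mem ⟨_, FinGraph.PsiBound.of_psiCBound (hC k hk).1⟩, fun _ h => Nat.sInf_le h⟩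
  have hF : ∀ k, 0 < k → IsLeast {c | FinGraph.PhiBound k c} (FinGraph.phi k) := fun k hk =>
    ⟨Nat.sInf_mem ⟨_, FinGraph.PhiBound.of_psiBound (hP k hk).1⟩, fun _ h => Nat.sInf_le h⟩
  have hFP : ∀ k, 0 < k → FinGraph.phi k ≤ FinGraph.psi k := fun k hk =>
    (hF k hk).2 (FinGraph.PhiBound.of_psiBound (hP k hk).1)
  have hPC : ∀ k, 0 < k → FinGraph.psi k ≤ FinGraph.psiC k := fun k hk =>
    (hP k hk).2 (FinGraph.PsiBound.of_psiCBound (hC k hk).1)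
  have hup : ∀ k, 0 < k → FinGraph.psiC k ≤ 2 * k ^ 2 - 1 := fun k hk =>
    (hC k hk).2 (FinGraph.psiCBound_two_mul_sq_sub_one hk)
  refine ⟨fun k hk => ⟨⟨hF k hk, hP k hk, hC k hk⟩, ⟨?_, hFP k hk, hPC k hk, hup k hk⟩,
    ⟨?_, hPC k hk, hup k hk⟩, FinGraph.logb_lt_of_phiBound hk (hF k hk).1,
    (hFP k hk).trans ((hPC k hk).trans (hup k hk))⟩, ?_⟩
  · rcases (by omega : k = 1 ∨ 2 ≤ k) with rfl | hk2
    · exact FinGraph.one_le_of_phiBound_one (hF 1 hk).1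
    · exact FinGraph.le_of_phiBound hk2 (hF k hk).1
  · rcases (by omega : k = 1 ∨ 2 ≤ k) with rfl | hk2
    · exact (FinGraph.one_le_of_phiBound_one (hF 1 hk).1).trans (hFP 1 hk)
    · exact FinGraph.le_of_psiBound hk2 (hP k hk).1
  · have h1 := FinGraph.five_le_of_phiBound_two (hF 2 two_pos).1
    have h2 := hFP 2 two_pos
    have h3 := hPC 2 two_pos
    have h4 := (hC 2 two_pos).2 FinGraph.psiCBound_two
    omega
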